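/- An $FL_{ew}$-algebra is a structure $\mathbf A=\langle A;\wedge,\vee,\cdot,\to,0,1\rangle$ such that $\langle A;\wedge,\vee,0,1\rangle$ is a bounded lattice, $\langle A;\cdot,1\rangle$ is a commutative monoid, and $a\cdot b\le c$ if and only if $a\le b\to c$. It is a chain if it is linearly ordered, $n$-contractive if $a^{n+1}=a^n$ for all $a\in A$, and weakly saturated if for all $a,b\in A$, $a\le b^n$ for all $n\in\mathbb N$ implies $ab=a$. Modal formulas are built from variables $p_0,p_1,\dots$ with $\wedge,\vee,\cdot,\to,0,1,\Box,\Diamond$ (and $\neg\varphi:=\varphi\to 0$). A frame $\langle W,R\rangle$ is a non-empty set $W$ with a relation $R\subseteq W\times W$. An $\mathbf A$-Kripke model over it is given by a map $e:W\times\{p_0,p_1,\dots\}\to A$, extended to formulas by interpreting the propositional connectives in $\mathbf A$ at each world and by $e(v,\Box\varphi)=\bigwedge_{Rvw}e(w,\varphi)$, $e(v,\Diamond\varphi)=\bigvee_{Rvw}e(w,\varphi)$; the model is safe if all these infima and suprema exist in $\mathbf A$. For a class $\mathcal C$ of safe models and a finite set $\Gamma\cup\{\varphi\}$ of formulas, $\Gamma\vdash_{\mathcal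 C}\varphi$ (global consequence) means that in every model of $\mathcal C$ in which every $\gamma\in\Gamma$ has value $1$ at all worlds, $\varphi$ has value $1$ at all worlds. The logic $\vdash_{\mathcal C}$ is decidable if the set of pairs $\langle\Gamma,\varphi\rangle$ with $\Gamma$ finite and $\Gamma\vdash_{\mathcal C}\varphi$ is recursive. Its three-variable fragment consists of those pairs in which only $p_0,p_1,p_2$ occur. **Corollary.** Let $\mathsf A$ be a class of weakly saturated $FL_{ew}$-chains such that for every $n\in\mathbb N$ some algebra in $\mathsf A$ is not $n$-contractive. Let $\mathsf T$ be a class of transitive frames that contains, for each $i\in\mathbb N$, a frame isomorphic to $\langle\{j\in\mathbb N: j\le i\},<\rangle$, and let $\mathsf T_{\mathsf A}$ be the class of all safe models over frames in $\mathsf T$ and algebras in $\mathsf A$. Then the global logic $\vdash_{\mathsf T_{\mathsf A}}$ is undecidable, and so is its three-variable fragment. In particular, for the class $K4\mathsf A$ of all safe models with transitive frame over algebras in $\mathsf A$, the global logic $\vdash_{K4\mathsf A}$ is undecidable, and so is its three-variable fragment. -/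

import Mathlib

set_option linter.checkUnivs false

universe u v

namespace MVModal

/-! ## Residuated lattices -/

/-- `FL_ew`-algebras: bounded lattices with a commutative monoid operation whose unit is the top
element, and a residual `res` (written `→` in the literature). -/
class FLew (A : Type u) extends Lattice A, BoundedOrder A, CommMonoid A where
  res : A → A → A
  one_eq_top : (1 : A) = ⊤
  mul_le_iff_le_res : ∀ a b c : A, a * b ≤ c ↔ a ≤ res b c

/-- Bundled `FL_ew`-algebras. A class of algebras is a `Set FLewAlg`. -/
structure FLewAlg : Type (u + 1) where
  carrier : Type u
  [str : FLew carrier]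

attribute [instance] FLewAlg.str

namespace FLewAlg

/-- The algebra is linearly ordered. -/
def IsChain (A : FLewAlg.{u}) : Prop :=
  ∀ a b : A.carrier, a ≤ b ∨ b ≤ a

/-- `a ^ (n + 1) = a ^ n` for all elements `a`. -/
def IsContractive (n : ℕ) (A : FLewAlg.{u}) : Prop :=
  ∀ a : A.carrier, a ^ (n + 1) = a ^ n

/-- If `a ≤ b ^ n` for all `n`, then `a * b = a`. -/
def IsWeaklySaturated (A : FLewAlg.{u}) : Prop :=
  ∀ a b : A.carrier, (∀ n : ℕ, a ≤ b ^ n) → a * b = a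

end FLewAlg

/-! ## Modal formulas -/

/-- Modal formulas over the variables `p₀, p₁, p₂, …`. The negation of `φ` is `imp φ zero`. -/
inductive Formula : Type
  | zero : Formula
  | one : Formula
  | var : ℕ → Formula
  | and : Formula → Formula → Formula
  | or : Formula → Formula → Formula
  | mul : Formula → Formula → Formula
  | imp : Formula → Formula → Formula
  | box : Formula → Formula
  | dia : Formula → Formula

namespace Formula

/-- The set of variables occurring in a formula. -/
def vars : Formula → Set ℕ
  | zero => ∅
  | one => ∅
  | var p => {p}
  | and φ ψ => vars φ ∪ vars ψ
  | or φ ψ => vars φ ∪ vars ψ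
  | mul φ ψ => vars φ ∪ vars ψ
  | imp φ ψ => vars φ ∪ vars ψ
  | box φ => vars φ
  | dia φ => vars φ

/-- The Gödel number of a formula. -/
def code : Formula → ℕ
  | zero => 0
  | one => 1
  | var p => 7 * p + 0 + 2
  | and φ ψ => 7 * Nat.pair (code φ) (code ψ) + 1 + 2
  | or φ ψ => 7 * Nat.pair (code φ) (code ψ) + 2 + 2
  | mul φ ψ => 7 * Nat.pair (code φ) (code ψ) + 3 + 2
  | imp φ ψ => 7 * Nat.pair (code φ) (code ψ) + 4 + 2
  | box φ => 7 * code φ + 5 + 2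
  | dia φ => 7 * code φ + 6 + 2

/-- The formula with a given Gödel number. -/
def ofCode : ℕ → Formula
  | 0 => zero
  | 1 => one
  | n + 2 =>
    have h : n / 7 < n + 2 := lt_of_le_of_lt (Nat.div_le_self n 7) (by omega)
    have h₁ : (n / 7).unpair.1 < n + 2 := lt_of_le_of_lt (Nat.unpair_left_le _) h
    have h₂ : (n / 7).unpair.2 < n + 2 := lt_of_le_of_lt (Nat.unpair_right_le _) h
    match n % 7 with
    | 0 => var (n / 7)
    | 1 => and (ofCode (n / 7).unpair.1) (ofCode (n / 7).unpair.2)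
    | 2 => or (ofCode (n / 7).unpair.1) (ofCode (n / 7).unpair.2)
    | 3 => mul (ofCode (n / 7).unpair.1) (ofCode (n / 7).unpair.2)
    | 4 => imp (ofCode (n / 7).unpair.1) (ofCode (n / 7).unpair.2)
    | 5 => box (ofCode (n / 7))
    | _ => dia (ofCode (n / 7))

theorem ofCode_code (φ : Formula) : ofCode (code φ) = φ := by
  have d : ∀ k i : ℕ, i < 7 → (7 * k + i) / 7 = k ∧ (7 * k + i) % 7 = i := by omega
  induction φ with
  | zero => simp [code, ofCode]
  | one => simp [code, ofCode]
  | var p => simp [code, ofCode]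
  | and φ ψ h₁ h₂ =>
    rw [code, ofCode, (d _ 1 (by omega)).2, (d _ 1 (by omega)).1]; simp [h₁, h₂]
  | or φ ψ h₁ h₂ =>
    rw [code, ofCode, (d _ 2 (by omega)).2, (d _ 2 (by omega)).1]; simp [h₁, h₂]
  | mul φ ψ h₁ h₂ =>
    rw [code, ofCode, (d _ 3 (by omega)).2, (d _ 3 (by omega)).1]; simp [h₁, h₂]
  | imp φ ψ h₁ h₂ =>
    rw [code, ofCode, (d _ 4 (by omega)).2, (d _ 4 (by omega)).1]; simp [h₁, h₂]
  | box φ h => rw [code, ofCode, (d _ 5 (by omega)).2, (d _ 5 (by omega)).1]; simp [h]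
  | dia φ h => rw [code, ofCode, (d _ 6 (by omega)).2, (d _ 6 (by omega)).1]; simp [h]

theorem code_ofCode (n : ℕ) : code (ofCode n) = n := by
  induction n using Nat.strong_induction_on with
  | _ n ih =>
    match n with
    | 0 => simp [code, ofCode]
    | 1 => simp [code, ofCode]
    | n + 2 =>
      have h : n / 7 < n + 2 := lt_of_le_of_lt (Nat.div_le_self n 7) (by omega)
      have h₁ := ih _ (lt_of_le_of_lt (Nat.unpair_left_le _) h)
      have h₂ := ih _ (lt_of_le_of_lt (Nat.unpair_right_le _) h)
      have h₀ := ih _ h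
      have hm := Nat.div_add_mod n 7
      have hl : n % 7 < 7 := Nat.mod_lt _ (by omega)
      rw [ofCode]
      generalize n % 7 = r at hm hl
      interval_cases r <;> simp only [code, h₀, h₁, h₂, Nat.pair_unpair] <;> omega

/-- Gödel numbering is a bijection; it provides the notion of computability on formulas. -/
instance : Denumerable Formula :=
  Denumerable.mk' ⟨code, ofCode, ofCode_code, code_ofCode⟩

end Formula

/-! ## Kripke frames and models -/

/-- Kripke frames: a non-empty set of worlds with a binary accessibility relation. -/
structure Frame : Type (v + 1) where
  World : Type v
  [nonempty : Nonempty World]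
  R : World → World → Prop

namespace Frame

/-- The accessibility relation is transitive. -/
def IsTransitive (F : Frame.{v}) : Prop :=
  ∀ x y z : F.World, F.R x y → F.R y z → F.R x z

/-- The frame `⟨{j ∈ ℕ : j ≤ i}, <⟩`. -/
def strictOrder (i : ℕ) : Frame.{0} where
  World := {j : ℕ // j ≤ i}
  nonempty := ⟨⟨0, Nat.zero_le i⟩⟩
  R x y := x.1 < y.1

end Frame

open Classical in
/-- The infimum of `s` if it exists (and an irrelevant value otherwise). -/
noncomputable def inf {A : Type u} [FLew A] (s : Set A) : A :=
  if h : ∃ a, IsGLB s a then h.choose else ⊤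

open Classical in
/-- The supremum of `s` if it exists (and an irrelevant value otherwise). -/
noncomputable def sup {A : Type u} [FLew A] (s : Set A) : A :=
  if h : ∃ a, IsLUB s a then h.choose else ⊤

/-- A Kripke model over an `FL_ew`-algebra: a frame and a valuation of the variables at worlds. -/
structure Model : Type (max (u + 1) (v + 1)) where
  alg : FLewAlg.{u}
  frame : Frame.{v}
  val : frame.World → ℕ → alg.carrier

namespace Model

/-- The extension of the valuation to all formulas. It is only used for safe models, in which all
the infima and suprema involved exist. -/
noncomputable def eval (M : Model.{u, v}) : M.frame.World → Formula → M.alg.carrier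
  | _, .zero => ⊥
  | _, .one => 1
  | w, .var p => M.val w p
  | w, .and φ ψ => eval M w φ ⊓ eval M w ψ
  | w, .or φ ψ => eval M w φ ⊔ eval M w ψ
  | w, .mul φ ψ => eval M w φ * eval M w ψ
  | w, .imp φ ψ => FLew.res (eval M w φ) (eval M w ψ)
  | w, .box φ => inf {a | ∃ w', M.frame.R w w' ∧ eval M w' φ = a}
  | w, .dia φ => sup {a | ∃ w', M.frame.R w w' ∧ eval M w' φ = a}

/-- A model is safe if the values of `□φ` and `◇φ` are defined for all formulas at all worlds. -/
def IsSafe (M : Model.{u, v}) : Prop :=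
  ∀ (w : M.frame.World) (φ : Formula),
    (∃ a, IsGLB {a | ∃ w', M.frame.R w w' ∧ M.eval w' φ = a} a) ∧
    (∃ a, IsLUB {a | ∃ w', M.frame.R w w' ∧ M.eval w' φ = a} a)

/-- `M ⊨ φ`: the formula takes the value `1` at every world. -/
def Satisfies (M : Model.{u, v}) (φ : Formula) : Prop :=
  ∀ w, M.eval w φ = 1

end Model

/-- The class of safe models over a frame in `T` and an algebra in `𝔸`. -/
def modelsOver (T : Set Frame.{v}) (𝔸 : Set FLewAlg.{u}) : Set Model.{u, v} :=
  {M | M.IsSafe ∧ M.frame ∈ T ∧ M.alg ∈ 𝔸}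

/-- The class `K4𝔸` of all safe transitive models over algebras in `𝔸`. -/
def K4 (𝔸 : Set FLewAlg.{u}) : Set Model.{u, v} :=
  {M | M.IsSafe ∧ M.frame.IsTransitive ∧ M.alg ∈ 𝔸}

/-! ## Global logics and decidability -/

/-- `φ` globally follows from the finite set `Γ` in the class `C` of models. -/
def GlobalConsequence (C : Set Model.{u, v}) (Γ : Finset Formula) (φ : Formula) : Prop :=
  ∀ M ∈ C, (∀ γ ∈ Γ, M.Satisfies γ) → M.Satisfies φ

/-- The global logic of a class of models, as a set of rules `⟨Γ, φ⟩`, where `Γ` is an arbitrary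
set of formulas: `φ` has to follow from a finite subset of `Γ`. -/
def globalLogic (C : Set Model.{u, v}) : Set (Set Formula × Formula) :=
  {r | ∃ Γ₀ : Finset Formula, (Γ₀ : Set Formula) ⊆ r.1 ∧ GlobalConsequence C Γ₀ r.2}

/-- The `n`-variable fragment: the rules in which only the variables `p₀, …, pₙ₋₁` occur. -/
def fragment (n : ℕ) (L : Set (Set Formula × Formula)) : Set (Set Formula × Formula) :=
  {r | r ∈ L ∧ (∀ γ ∈ r.1, γ.vars ⊆ {p | p < n}) ∧ r.2.vars ⊆ {p | p < n}}

/-- A logic is decidable if the set of its rules with finitely many premises (presented as lists)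
is decidable, that is, recursive. -/
def IsDecidable (L : Set (Set Formula × Formula)) : Prop :=
  ComputablePred fun r : List Formula × Formula => ({γ | γ ∈ r.1}, r.2) ∈ L

end MVModal

namespace MVModal

/-! ## Residuated lattices -/

namespace FLew

variable {A : Type u} [FLew A]

/-! Non-halting is reduced to global consequence. Halting becomes the question whether some (X, Y)
with X = P·Y + Q is reachable from (x₀, 0) by pairs of affine maps. A run is stored in exponents of
one truth value z = p₂, with p₀ = z^X and p₁ = z^Y: dead ends carry the initial values, every other
world gets its values from □p₀ and □p₁ by one of the pairs. The premises say this, keep z constant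
along R, and contain □(p₀p₁) → □p₀·□p₁.

A run of length i gives a countermodel on {0, …, i} (`exists_model_of_affineReach`). Exponents grow
towards the root, so the meet over all later worlds is the value at the next one.

Conversely (`affineReach_of_model`), let the conclusion fail at w₀ and let b be the product of the
two sides of the goal equation. Then b·z ≠ b, so by weak saturation b is not below all powers of z,
and c·z ≠ c whenever c ≥ b. At w₀ and its successors p₀·p₁ stays above b, while p₁ gains a factor z
with each step towards w₀; this allows an induction without well-foundedness of R. The values at the
successors of a world are finitely many powers of z, so the boxes are attained, and the premise on
products forces □p₀ and □p₁ to be attained at a common world. Hence the exponents at w₀ form a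
reachable pair, and they solve the goal equation.

Affine maps append words written in base B, and X = P·Y + Q becomes an identity between concatenated
words, as in Post's correspondence problem (`exists_affine`). This expresses derivability in a
semi-Thue system, which simulates a stack machine (`exists_semiThue`). -/

theorem mul_mono_left {a b : A} (h : a ≤ b) (c : A) : a * c ≤ b * c :=
  (mul_le_iff_le_res _ _ _).2 (h.trans ((mul_le_iff_le_res _ _ _).1 le_rfl))

instance : IsOrderedMonoid A where
  mul_le_mul_left _ _ h c := mul_mono_left h c

theorem le_one (a : A) : a ≤ 1 := one_eq_top (A := A) ▸ le_top

theorem mul_le_left (a b : A) : a * b ≤ a := by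
  simpa using mul_le_mul' (le_refl a) (le_one b)

theorem mul_le_right (a b : A) : a * b ≤ b := by
  simpa using mul_le_mul' (le_one a) (le_refl b)

theorem res_mul_le (a b : A) : res a b * a ≤ b := (mul_le_iff_le_res _ _ _).2 le_rfl

theorem res_eq_one {a b : A} : res a b = 1 ↔ a ≤ b := by
  constructor
  · intro h
    simpa [h] using res_mul_le a b
  · intro h
    exact le_antisymm (le_one _) ((mul_le_iff_le_res _ _ _).1 (by simpa using h))

theorem eq_one_iff {a : A} : a = 1 ↔ 1 ≤ a :=
  ⟨fun h => h ▸ le_rfl, fun h => le_antisymm (le_one _) h⟩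

theorem inf_eq_one {a b : A} : a ⊓ b = 1 ↔ a = 1 ∧ b = 1 := by
  simp only [eq_one_iff, le_inf_iff]

theorem pow_anti (a : A) {m n : ℕ} (h : m ≤ n) : a ^ n ≤ a ^ m := by
  obtain ⟨k, rfl⟩ := Nat.exists_eq_add_of_le h
  rw [pow_add]
  exact mul_le_left _ _

theorem pow_le_self (a : A) {n : ℕ} (h : 1 ≤ n) : a ^ n ≤ a := by
  simpa using pow_anti a h

end FLew

open FLew

/-! ### Boxes and diamonds in safe models -/

namespace Model

variable {M : Model.{u, v}}

theorem IsSafe.isGLB_box (h : M.IsSafe) (w : M.frame.World) (φ : Formula) :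
    IsGLB {a | ∃ w', M.frame.R w w' ∧ M.eval w' φ = a} (M.eval w (.box φ)) := by
  have := (h w φ).1
  simp only [eval, inf, dif_pos this]
  exact this.choose_spec

theorem IsSafe.isLUB_dia (h : M.IsSafe) (w : M.frame.World) (φ : Formula) :
    IsLUB {a | ∃ w', M.frame.R w w' ∧ M.eval w' φ = a} (M.eval w (.dia φ)) := by
  have := (h w φ).2
  simp only [eval, sup, dif_pos this]
  exact this.choose_spec

theorem IsSafe.box_le (h : M.IsSafe) {w w' : M.frame.World} (hR : M.frame.R w w') (φ : Formula) :
    M.eval w (.box φ) ≤ M.eval w' φ := (h.isGLB_box w φ).1 ⟨w', hR, rfl⟩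

theorem IsSafe.le_dia (h : M.IsSafe) {w w' : M.frame.World} (hR : M.frame.R w w') (φ : Formula) :
    M.eval w' φ ≤ M.eval w (.dia φ) := (h.isLUB_dia w φ).1 ⟨w', hR, rfl⟩

theorem IsSafe.box_of_dead_end (h : M.IsSafe) {w : M.frame.World}
    (hw : ∀ w', ¬ M.frame.R w w') (φ : Formula) : M.eval w (.box φ) = 1 :=
  le_antisymm (le_one _) ((h.isGLB_box w φ).2 (by rintro _ ⟨w', hR, -⟩; exact (hw w' hR).elim))

theorem IsSafe.box_eq_of_min (h : M.IsSafe) {w w' : M.frame.World} (hR : M.frame.R w w')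
    {φ : Formula} (hmin : ∀ w'', M.frame.R w w'' → M.eval w' φ ≤ M.eval w'' φ) :
    M.eval w (.box φ) = M.eval w' φ :=
  le_antisymm (h.box_le hR φ)
    ((h.isGLB_box w φ).2 (by rintro _ ⟨w'', hR', rfl⟩; exact hmin w'' hR'))

theorem isSafe_of_finite [Finite M.frame.World] : M.IsSafe := by
  intro w φ
  have hf : {a | ∃ w', M.frame.R w w' ∧ M.eval w' φ = a}.Finite :=
    (Set.finite_range fun w' => M.eval w' φ).subset (by rintro _ ⟨w', -, rfl⟩; exact ⟨w', rfl⟩)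
  refine ⟨⟨hf.toFinset.inf id, ?_⟩, ⟨hf.toFinset.sup id, ?_⟩⟩
  · simpa using (Finset.isGLB_inf_id (s := hf.toFinset))
  · simpa using (Finset.isLUB_sup_id (s := hf.toFinset))

end Model

namespace Formula

/-- The `n`-fold product of a formula with itself. -/
def pow (φ : Formula) (n : ℕ) : Formula := n.rec one fun _ ψ => mul ψ φ

/-- The biconditional. -/
def iff (φ ψ : Formula) : Formula := and (imp φ ψ) (imp ψ φ)

theorem vars_pow_subset (φ : Formula) (n : ℕ) : (pow φ n).vars ⊆ φ.vars := by
  induction n with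
  | zero => simp [pow, vars]
  | succ n ih => exact Set.union_subset ih subset_rfl

theorem vars_iff (φ ψ : Formula) : (iff φ ψ).vars = φ.vars ∪ ψ.vars := by
  simp only [iff, vars]
  ext; simp; tauto

end Formula

namespace Model

variable {M : Model.{u, v}} {w : M.frame.World}

theorem eval_pow (φ : Formula) (n : ℕ) : M.eval w (φ.pow n) = M.eval w φ ^ n := by
  induction n with
  | zero => simp [Formula.pow, eval]
  | succ n ih => rw [pow_succ, ← ih]; rfl

theorem eval_imp_eq_one {φ ψ : Formula} :
    M.eval w (.imp φ ψ) = 1 ↔ M.eval w φ ≤ M.eval w ψ := res_eq_one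

theorem eval_and_eq_one {φ ψ : Formula} :
    M.eval w (.and φ ψ) = 1 ↔ M.eval w φ = 1 ∧ M.eval w ψ = 1 := inf_eq_one

theorem eval_or_eq_one (hA : M.alg.IsChain) {φ ψ : Formula} :
    M.eval w (.or φ ψ) = 1 ↔ M.eval w φ = 1 ∨ M.eval w ψ = 1 := by
  simp only [eval, eq_one_iff]
  rcases hA (M.eval w φ) (M.eval w ψ) with h | h
  · rw [sup_eq_right.2 h]; exact ⟨Or.inr, fun h' => h'.elim (fun h' => h'.trans h) id⟩
  · rw [sup_eq_left.2 h]; exact ⟨Or.inl, fun h' => h'.elim id (fun h' => h'.trans h)⟩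

theorem eval_iff_eq_one {φ ψ : Formula} :
    M.eval w (.iff φ ψ) = 1 ↔ M.eval w φ = M.eval w ψ := by
  rw [Formula.iff, eval_and_eq_one, eval_imp_eq_one, eval_imp_eq_one]
  exact le_antisymm_iff.symm

theorem eval_mul (φ ψ : Formula) : M.eval w (.mul φ ψ) = M.eval w φ * M.eval w ψ := rfl

theorem eval_neg_box_zero (hs : M.IsSafe) {w' : M.frame.World} (hR : M.frame.R w w') :
    M.eval w (.imp (.box .zero) .zero) = 1 :=
  eval_imp_eq_one.2 (hs.box_le hR .zero)

end Model

/-! ## Pairs of affine maps -/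

/-- A pair of affine maps `X ↦ p X + q` and `Y ↦ r Y + s`. -/
structure AffinePair where
  p : ℕ
  q : ℕ
  r : ℕ
  s : ℕ

/-- The second map is increasing and the first one is not decreasing. -/
def AffinePair.IsGrowing (t : AffinePair) : Prop := 1 ≤ t.p ∧ 1 ≤ t.r ∧ 1 ≤ t.s

/-- The pairs that can be reached from `(x₀, 0)` by pairs of maps from a list. -/
inductive AffineReach (L : List AffinePair) (x₀ : ℕ) : ℕ → ℕ → Prop
  | init : AffineReach L x₀ x₀ 0
  | step {t : AffinePair} (ht : t ∈ L) {X Y : ℕ} (h : AffineReach L x₀ X Y) :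
      AffineReach L x₀ (t.p * X + t.q) (t.r * Y + t.s)

/-- The run is listed backwards, to match a frame whose root is 0 and whose dead end is i. -/
theorem AffineReach.exists_seq {L : List AffinePair} {x₀ X Y : ℕ} (h : AffineReach L x₀ X Y) :
    ∃ (i : ℕ) (f g : ℕ → ℕ), f i = x₀ ∧ g i = 0 ∧ f 0 = X ∧ g 0 = Y ∧
      ∀ j < i, ∃ t ∈ L, f j = t.p * f (j + 1) + t.q ∧ g j = t.r * g (j + 1) + t.s := by
  induction h with
  | init => exact ⟨0, fun _ => x₀, fun _ => 0, rfl, rfl, rfl, rfl, by simp⟩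
  | @step t ht X Y _ ih =>
    obtain ⟨i, f, g, hf, hg, rfl, rfl, hs⟩ := ih
    refine ⟨i + 1, fun j => j.casesOn (t.p * f 0 + t.q) f, fun j => j.casesOn (t.r * g 0 + t.s) g,
      hf, hg, rfl, rfl, fun j hj => ?_⟩
    cases j with
    | zero => exact ⟨t, ht, rfl, rfl⟩
    | succ j => exact hs j (by omega)

namespace AffinePair

open Formula

/-- The formula expressing that the pair of maps leads from the values at the successors of a world
to the values at the world. -/
def formula (t : AffinePair) : Formula :=
  and (imp (box zero) zero)
    (and (iff (var 0) (mul (pow (box (var 0)) t.p) (pow (var 2) t.q)))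
      (iff (var 1) (mul (pow (box (var 1)) t.r) (pow (var 2) t.s))))

/-- The formula describing the values at the worlds without successors. -/
def initFormula (x₀ : ℕ) : Formula :=
  and (box zero) (and (iff (var 0) (pow (var 2) x₀)) (iff (var 1) one))

/-- At each world the values are the initial ones or come from those at the successors. -/
def stepFormula (L : List AffinePair) (x₀ : ℕ) : Formula :=
  L.foldr (fun t ψ => or t.formula ψ) (initFormula x₀)

/-- The premises that describe the models coding affine reachability. -/
def premises (L : List AffinePair) (x₀ : ℕ) : List Formula :=
  [imp (var 2) (box (var 2)), imp (dia (var 2)) (var 2),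
    imp (box (mul (var 0) (var 1))) (mul (box (var 0)) (box (var 1))), stepFormula L x₀]

/-- The right-hand side of the goal equation `X = P Y + Q`. -/
def target (P Q : ℕ) : Formula := mul (pow (var 1) P) (pow (var 2) Q)

/-- The formula refuted in a model exactly when the goal `X = P Y + Q` is reached. -/
def conclusion (P Q : ℕ) : Formula :=
  imp (iff (var 0) (target P Q))
    (imp (mul (var 0) (target P Q)) (mul (mul (var 0) (target P Q)) (var 2)))

theorem vars_var_pow {i : ℕ} (hi : i < 3) (n : ℕ) : (pow (var i) n).vars ⊆ {p | p < 3} :=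
  (vars_pow_subset _ n).trans (Set.singleton_subset_iff.2 hi)

theorem vars_box_var_pow {i : ℕ} (hi : i < 3) (n : ℕ) :
    (pow (box (var i)) n).vars ⊆ {p | p < 3} :=
  (vars_pow_subset _ n).trans (Set.singleton_subset_iff.2 hi)

theorem vars_premises (L : List AffinePair) (x₀ : ℕ) :
    ∀ φ ∈ premises L x₀, φ.vars ⊆ {p | p < 3} := by
  have hS : (stepFormula L x₀).vars ⊆ {p | p < 3} := by
    induction L with
    | nil =>
      simp only [stepFormula, initFormula, List.foldr_nil, vars_iff, vars, Set.union_subset_iff,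
        Set.empty_subset, Set.singleton_subset_iff, Set.mem_ofPred_eq]
      simpa using vars_var_pow (by norm_num) x₀
    | cons t L ih =>
      refine Set.union_subset ?_ ih
      simp only [formula, vars_iff, vars, Set.union_subset_iff, Set.empty_subset,
        Set.singleton_subset_iff, Set.mem_ofPred_eq]
      simpa using ⟨⟨vars_box_var_pow (by norm_num) t.p, vars_var_pow (by norm_num) t.q⟩,
        vars_box_var_pow (by norm_num) t.r, vars_var_pow (by norm_num) t.s⟩
  simp only [premises, List.forall_mem_cons, vars, Set.union_subset_iff, Set.singleton_subset_iff,
    Set.mem_ofPred_eq]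
  simp [hS]

theorem vars_conclusion (P Q : ℕ) : (conclusion P Q).vars ⊆ {p | p < 3} := by
  simp only [conclusion, target, vars_iff, vars, Set.union_subset_iff, Set.singleton_subset_iff,
    Set.mem_ofPred_eq]
  simpa using ⟨vars_var_pow (by norm_num) P, vars_var_pow (by norm_num) Q⟩

/-! ### Truth conditions of the coding formulas -/

section

variable {M : Model.{u, v}} {w : M.frame.World}

theorem eval_stepFormula_eq_one (hA : M.alg.IsChain) {L : List AffinePair} {x₀ : ℕ} :
    M.eval w (stepFormula L x₀) = 1 ↔
      (∃ t ∈ L, M.eval w t.formula = 1) ∨ M.eval w (initFormula x₀) = 1 := by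
  induction L with
  | nil => simp [stepFormula]
  | cons t L ih =>
    have : stepFormula (t :: L) x₀ = or t.formula (stepFormula L x₀) := rfl
    rw [this, Model.eval_or_eq_one hA, ih]
    simp [or_assoc]

theorem eval_formula_eq_one {t : AffinePair} :
    M.eval w t.formula = 1 ↔ M.eval w (imp (box zero) zero) = 1 ∧
      M.eval w (var 0) = M.eval w (box (var 0)) ^ t.p * M.eval w (var 2) ^ t.q ∧
      M.eval w (var 1) = M.eval w (box (var 1)) ^ t.r * M.eval w (var 2) ^ t.s := by
  simp only [formula, Model.eval_and_eq_one, Model.eval_iff_eq_one, Model.eval_mul, Model.eval_pow]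

theorem eval_initFormula_eq_one {x₀ : ℕ} :
    M.eval w (initFormula x₀) = 1 ↔ M.eval w (box zero) = 1 ∧
      M.eval w (var 0) = M.eval w (var 2) ^ x₀ ∧ M.eval w (var 1) = 1 := by
  simp only [initFormula, Model.eval_and_eq_one, Model.eval_iff_eq_one, Model.eval_pow]
  rfl

theorem eval_target (P Q : ℕ) :
    M.eval w (target P Q) = M.eval w (var 1) ^ P * M.eval w (var 2) ^ Q := by
  simp only [target, Model.eval_mul, Model.eval_pow]

end

end AffinePair

/-! ## Reduction of affine reachability to global consequence -/

namespace FLew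

variable {A : Type u} [FLew A]

theorem le_pow_of_mul_eq {b z : A} (h : b * z = b) (n : ℕ) : b ≤ z ^ n := by
  have : b * z ^ n = b := by
    induction n with
    | zero => simp
    | succ n ih => rw [pow_succ, ← mul_assoc, ih, h]
  exact this ▸ mul_le_right b (z ^ n)

theorem lt_of_pow_lt_pow {z : A} {m n : ℕ} (h : z ^ m < z ^ n) : n < m := by
  by_contra hc
  exact (pow_anti z (not_lt.1 hc)).not_gt h

/-- (x → d)·x·d ≤ d·d ≤ x·z·d. With this, a gap of one factor z between the two sides of the goal
equation makes the conclusion true. -/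
theorem res_le_res_mul {x d z : A} (h : d ≤ x * z) : res x d ≤ res (x * d) (x * d * z) := by
  rw [← mul_le_iff_le_res]
  calc res x d * (x * d) = res x d * x * d := by rw [mul_assoc]
    _ ≤ d * d := mul_mono_left (res_mul_le _ _) _
    _ ≤ x * z * d := mul_mono_left h _
    _ = x * d * z := mul_right_comm _ _ _

end FLew

namespace AffinePair

open Formula FLew

variable {M : Model.{u, v}} {L : List AffinePair} {x₀ P Q : ℕ}

theorem affineReach_of_model (hs : M.IsSafe) (hT : M.frame.IsTransitive) (hA : M.alg.IsChain)
    (hsat : M.alg.IsWeaklySaturated) (hL : ∀ t ∈ L, t.IsGrowing) (hP : 1 ≤ P)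
    (hΓ : ∀ φ ∈ premises L x₀, M.Satisfies φ) (hφ : ¬ M.Satisfies (conclusion P Q)) :
    ∃ X Y, AffineReach L x₀ X Y ∧ X = P * Y + Q := by
  simp only [premises, List.forall_mem_cons] at hΓ
  obtain ⟨h₁, h₂, h₃, h₄, -⟩ := hΓ
  obtain ⟨w₀, hw₀⟩ := not_forall.1 hφ
  rw [conclusion, Model.eval_imp_eq_one] at hw₀
  set x : M.frame.World → M.alg.carrier := fun w => M.eval w (var 0) with hx
  set y : M.frame.World → M.alg.carrier := fun w => M.eval w (var 1) with hy
  set z := M.eval w₀ (var 2) with hz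
  set d := y w₀ ^ P * z ^ Q with hd
  set b := x w₀ * d with hb
  -- If c·z = c, then c, and with it b, is below every power of z; weak saturation gives b·z = b,
  -- and the conclusion holds at w₀.
  have hbz : ∀ {c}, b ≤ c → c * z ≠ c := by
    intro c hc h
    have : b * z = b := hsat _ _ fun n => hc.trans (le_pow_of_mul_eq h n)
    apply hw₀
    have h' : M.eval w₀ (imp (mul (var 0) (target P Q)) (mul (mul (var 0) (target P Q)) (var 2)))
        = 1 := by
      rw [Model.eval_imp_eq_one]
      simp only [Model.eval_mul, eval_target]
      exact this.ge
    rw [h']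
    exact le_one _
  obtain ⟨n, hn⟩ : ∃ n, ¬ b ≤ z ^ n := by
    by_contra! h
    exact hbz le_rfl (hsat _ _ h)
  -- Transitivity closes this set under R.
  let C : M.frame.World → Prop := fun w => w = w₀ ∨ M.frame.R w₀ w
  have hC : ∀ {w w'}, C w → M.frame.R w w' → C w' := by
    rintro w w' (rfl | h) h'
    · exact Or.inr h'
    · exact Or.inr (hT _ _ _ h h')
  have hzC : ∀ {w}, C w → M.eval w (var 2) = z := by
    rintro w (rfl | h)
    · rfl
    · exact le_antisymm ((hs.le_dia h _).trans (Model.eval_imp_eq_one.1 (h₂ w₀)))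
        ((Model.eval_imp_eq_one.1 (h₁ w₀)).trans (hs.box_le h _))
  -- Since b·z ≠ b, the algebra has 0 ≠ 1, so □0 really separates dead ends from other worlds.
  have cases : ∀ {w}, C w → (∃ t ∈ L, (∃ w', M.frame.R w w') ∧
        x w = M.eval w (box (var 0)) ^ t.p * z ^ t.q ∧
        y w = M.eval w (box (var 1)) ^ t.r * z ^ t.s) ∨
      ((∀ w', ¬ M.frame.R w w') ∧ x w = z ^ x₀ ∧ y w = 1) := by
    intro w hw
    have htriv : M.eval w zero ≠ 1 := fun h =>
      hbz le_rfl (le_antisymm (mul_le_left _ _) ((le_one b).trans (h ▸ bot_le)))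
    rcases (eval_stepFormula_eq_one hA).1 (h₄ w) with ⟨t, ht, h⟩ | h
    · rw [eval_formula_eq_one, hzC hw] at h
      refine Or.inl ⟨t, ht, ?_, h.2⟩
      by_contra! hd
      have := Model.eval_imp_eq_one.1 h.1
      rw [hs.box_of_dead_end hd] at this
      exact htriv (eq_one_iff.2 this)
    · rw [eval_initFormula_eq_one, hzC hw] at h
      refine Or.inr ⟨fun w' hR => htriv (eq_one_iff.2 ?_), h.2⟩
      exact h.1 ▸ hs.box_le hR zero
  have hxle : ∀ {w w'}, C w → M.frame.R w w' → x w ≤ x w' := by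
    intro w w' hw hR
    rcases cases hw with ⟨t, ht, -, h, -⟩ | ⟨h, -⟩
    · rw [h]
      exact (mul_le_left _ _).trans ((pow_le_self _ (hL t ht).1).trans (hs.box_le hR _))
    · exact (h w' hR).elim
  have hyle : ∀ {w w'}, C w → M.frame.R w w' → y w ≤ y w' * z := by
    intro w w' hw hR
    rcases cases hw with ⟨t, ht, -, -, h⟩ | ⟨h, -⟩
    · rw [h]
      exact mul_le_mul' ((pow_le_self _ (hL t ht).2.1).trans (hs.box_le hR _))
        (pow_le_self _ (hL t ht).2.2)
    · exact (h w' hR).elim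
  have hb₀ : b ≤ x w₀ * y w₀ :=
    mul_le_mul' le_rfl ((mul_le_left _ _).trans (pow_le_self _ hP))
  have hbC : ∀ {w}, C w → b ≤ x w * y w := by
    rintro w (rfl | h)
    · exact hb₀
    · exact hb₀.trans (mul_le_mul' (hxle (Or.inl rfl) h)
        ((hyle (Or.inl rfl) h).trans (mul_le_left _ _)))
  have hlt : ∀ {c X}, b ≤ c → c = z ^ X → X < n := by
    intro c X hc h
    by_contra! hX
    exact hn (hc.trans (h ▸ pow_anti z hX))
  have hfac : ∀ {c c' : M.alg.carrier} {X X' : ℕ}, c = z ^ X → c' = z ^ X' → c ≤ c' → c ≠ c' →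
      c ≤ c' * z := by
    rintro c c' X X' rfl rfl h h'
    rw [← pow_succ]
    exact pow_anti z (lt_of_pow_lt_pow (lt_of_le_of_ne h h'))
  -- Passing to a successor lowers the bound k by one, as y w ≤ y w'·z.
  have main : ∀ k w, C w → ¬ y w ≤ z ^ k →
      ∃ X Y, AffineReach L x₀ X Y ∧ x w = z ^ X ∧ y w = z ^ Y := by
    intro k
    induction k with
    | zero => intro w _ h; exact (h (by simpa using le_one _)).elim
    | succ k ih =>
      intro w hw hk
      rcases cases hw with ⟨t, ht, ⟨w₁, hw₁⟩, htx, hty⟩ | ⟨-, hx0, hy0⟩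
      · have ih' : ∀ w', M.frame.R w w' →
            ∃ X Y, AffineReach L x₀ X Y ∧ x w' = z ^ X ∧ y w' = z ^ Y := by
          intro w' hR
          refine ih w' (hC hw hR) fun h => hk ((hyle hw hR).trans ?_)
          rw [pow_succ]
          exact mul_mono_left h z
        -- Powers of z above b have exponents below n, so f has finitely many values on the
        -- successors, hence a least one.
        have hmin : ∀ f : M.frame.World → M.alg.carrier,
            (∀ w', M.frame.R w w' → ∃ N, f w' = z ^ N) →
            (∀ w', M.frame.R w w' → b ≤ f w') →
            ∃ w', M.frame.R w w' ∧ ∀ w'', M.frame.R w w'' → f w' ≤ f w'' := by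
          intro f hf hbf
          have hfin : (f '' {w' | M.frame.R w w'}).Finite := by
            refine ((Set.finite_lt_nat n).image (z ^ ·)).subset ?_
            rintro _ ⟨w', hR, rfl⟩
            obtain ⟨N, hN⟩ := hf w' hR
            exact ⟨N, hlt (hbf w' hR) hN, hN.symm⟩
          obtain ⟨_, ⟨⟨w', hR, rfl⟩, hmin⟩⟩ := hfin.exists_minimal ⟨f w₁, w₁, hw₁, rfl⟩
          refine ⟨w', hR, fun w'' hR' => ?_⟩
          rcases hA (f w') (f w'') with h | h
          · exact h
          · exact hmin ⟨w'', hR', rfl⟩ h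
        obtain ⟨wx, hRx, hwx⟩ := hmin x (fun w' hR => let ⟨X, _, _, h, _⟩ := ih' w' hR; ⟨X, h⟩)
          fun w' hR => (hbC (hC hw hR)).trans (mul_le_left _ _)
        obtain ⟨wy, hRy, hwy⟩ := hmin y (fun w' hR => let ⟨_, Y, _, _, h⟩ := ih' w' hR; ⟨Y, h⟩)
          fun w' hR => (hbC (hC hw hR)).trans (mul_le_right _ _)
        obtain ⟨w', hR, hw'⟩ := hmin (fun w => x w * y w)
          (fun w' hR => let ⟨X, Y, _, h, h'⟩ := ih' w' hR; ⟨X + Y, by rw [h, h', pow_add]⟩)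
          fun w' hR => hbC (hC hw hR)
        have ex : M.eval w (box (var 0)) = x wx := hs.box_eq_of_min hRx hwx
        have ey : M.eval w (box (var 1)) = y wy := hs.box_eq_of_min hRy hwy
        have exy : M.eval w (box (mul (var 0) (var 1))) = x w' * y w' :=
          hs.box_eq_of_min hR (φ := mul (var 0) (var 1)) hw'
        have hprod := Model.eval_imp_eq_one.1 (h₃ w)
        rw [exy, Model.eval_mul, ex, ey] at hprod
        obtain ⟨X, Y, hXY, hX, hY⟩ := ih' w' hR
        obtain ⟨X₁, _, _, hX₁, _⟩ := ih' wx hRx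
        obtain ⟨_, Y₁, _, _, hY₁⟩ := ih' wy hRy
        have hne := hbz (hbC (hC hw hR))
        -- Put c = x w'·y w', the value of the box of the product. If a factor were smaller at its
        -- own minimum than at w', it would lose a factor z, and the premise on products would give
        -- c ≤ c·z, against `hbz`.
        have exw : x wx = x w' := by
          by_contra h
          refine hne (le_antisymm (mul_le_left _ _) (hprod.trans ?_))
          rw [mul_right_comm]
          exact mul_le_mul' (hfac hX₁ hX (hwx w' hR) h) (hwy w' hR)
        have eyw : y wy = y w' := by
          by_contra h
          refine hne (le_antisymm (mul_le_left _ _) (hprod.trans ?_))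
          rw [mul_assoc]
          exact mul_le_mul' (hwx w' hR) (hfac hY₁ hY (hwy w' hR) h)
        refine ⟨_, _, hXY.step ht, ?_, ?_⟩
        · rw [htx, ex, exw, hX, ← pow_mul, ← pow_add, mul_comm]
        · rw [hty, ey, eyw, hY, ← pow_mul, ← pow_add, mul_comm]
      · exact ⟨x₀, 0, .init, hx0, by rw [hy0, pow_zero]⟩
  obtain ⟨X, Y, hXY, hX, hY⟩ := main n w₀ (Or.inl rfl)
    fun h => hn (hb₀.trans ((mul_le_right _ _).trans h))
  refine ⟨X, Y, hXY, ?_⟩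
  have hdz : d = z ^ (P * Y + Q) := by rw [hd, hY, ← pow_mul, ← pow_add, mul_comm]
  have hnot : ¬ res (x w₀) d ⊓ res d (x w₀) ≤ res b (b * z) := by
    intro h
    refine hw₀ (le_trans ?_ (h.trans ?_)) <;>
    · simp only [iff, Model.eval, eval_target]
      exact le_rfl
  by_contra hne
  rcases Nat.lt_or_gt_of_ne hne with h | h
  · refine hnot (inf_le_left.trans (res_le_res_mul ?_))
    rw [hX, hdz, ← pow_succ]
    exact pow_anti z h
  · refine hnot (inf_le_right.trans ((res_le_res_mul (z := z) ?_).trans_eq ?_))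
    · rw [hX, hdz, ← pow_succ]
      exact pow_anti z h
    · rw [mul_comm d]

theorem exists_model_of_affineReach {T : Set Frame.{v}} {𝔸 : Set FLewAlg.{u}}
    (hchain : ∀ A ∈ 𝔸, A.IsChain) (hcontr : ∀ n : ℕ, ∃ A ∈ 𝔸, ¬ A.IsContractive n)
    (hT : ∀ i : ℕ, ∃ F ∈ T, Nonempty ((Frame.strictOrder i).R ≃r F.R))
    (hL : ∀ t ∈ L, t.IsGrowing) {X Y : ℕ} (h : AffineReach L x₀ X Y) (hXY : X = P * Y + Q) :
    ∃ M ∈ modelsOver T 𝔸, (∀ φ ∈ premises L x₀, M.Satisfies φ) ∧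
      ¬ M.Satisfies (conclusion P Q) := by
  obtain ⟨i, f, g, hf, hg, rfl, rfl, hfg⟩ := h.exists_seq
  -- At the root p₀ and the target both equal a^(f 0), so refuting the conclusion needs a^(f 0 + f
  -- 0) to differ from the next power.
  obtain ⟨A, hA, hc⟩ := hcontr (f 0 + f 0)
  obtain ⟨a, ha⟩ := not_forall.1 hc
  obtain ⟨F, hF, ⟨e⟩⟩ := hT i
  let idx : F.World → ℕ := fun w => (e.symm w).1
  have hidx : ∀ w, idx w ≤ i := fun w => (e.symm w).2
  have hR : ∀ w w', F.R w w' ↔ idx w < idx w' := fun w w' => e.symm.map_rel_iff.symm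
  have hsurj : ∀ j ≤ i, ∃ w, idx w = j := fun j hj =>
    ⟨e ⟨j, hj⟩, congrArg Subtype.val (e.symm_apply_apply ⟨j, hj⟩)⟩
  let M : Model.{u, v} :=
    { alg := A
      frame := F
      val := fun w p => match p with
        | 0 => a ^ f (idx w)
        | 1 => a ^ g (idx w)
        | _ => a }
  have hfin : Finite M.frame.World :=
    have : Finite (Frame.strictOrder i).World := (Set.finite_le_nat i)
    Finite.of_equiv _ e.toEquiv
  have hs : M.IsSafe := Model.isSafe_of_finite
  have hch : M.alg.IsChain := hchain A hA
  have ex : ∀ w : M.frame.World, M.eval w (var 0) = a ^ f (idx w) := fun w => rfl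
  have ey : ∀ w : M.frame.World, M.eval w (var 1) = a ^ g (idx w) := fun w => rfl
  have ez : ∀ w : M.frame.World, M.eval w (var 2) = a := fun w => rfl
  have hmono : ∀ {j k}, j ≤ k → k ≤ i → f k ≤ f j ∧ g k ≤ g j := by
    intro j k hjk
    induction k, hjk using Nat.le_induction with
    | base => exact fun _ => ⟨le_rfl, le_rfl⟩
    | succ k _ ih =>
      intro hk
      obtain ⟨t, ht, h₁, h₂⟩ := hfg k (by omega)
      obtain ⟨hp, hr, -⟩ := hL t ht
      have h₃ := Nat.le_mul_of_pos_left (f (k + 1)) hp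
      have h₄ := Nat.le_mul_of_pos_left (g (k + 1)) hr
      have := ih (by omega)
      omega
  -- Among all successors the next world has the largest exponent, hence the least value.
  have hnext : ∀ (w : M.frame.World) (φ : Formula) (h : ℕ → ℕ),
      (∀ w' : M.frame.World, M.eval w' φ = a ^ h (idx w')) →
      (∀ {j k}, j ≤ k → k ≤ i → h k ≤ h j) → idx w < i →
      M.eval w (box φ) = a ^ h (idx w + 1) := by
    intro w φ h hφ hh hw
    obtain ⟨w', hw'⟩ := hsurj (idx w + 1) hw
    rw [hs.box_eq_of_min (w' := w') ((hR _ _).2 (by omega)), hφ, hw']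
    intro w'' hR'
    rw [hφ, hφ, hw']
    exact pow_anti a (hh ((hR _ _).1 hR') (hidx _))
  have hdead : ∀ w : M.frame.World, ¬ idx w < i → ∀ w', ¬ M.frame.R w w' := fun w hw w' h =>
    hw (((hR _ _).1 h).trans_le (hidx w'))
  have exy : ∀ w : M.frame.World, M.eval w (mul (var 0) (var 1)) = a ^ (f (idx w) + g (idx w)) :=
    fun w => by rw [Model.eval_mul, ex, ey, pow_add]
  refine ⟨M, ⟨hs, hF, hA⟩, ?_, ?_⟩
  · simp only [premises, List.forall_mem_cons, List.not_mem_nil, false_imp_iff, implies_true,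
      and_true]
    refine ⟨fun w => ?_, fun w => ?_, fun w => ?_, fun w => ?_⟩
    · rw [Model.eval_imp_eq_one]
      exact (hs.isGLB_box w _).2 (by rintro _ ⟨w', -, rfl⟩; exact le_rfl)
    · rw [Model.eval_imp_eq_one]
      exact (hs.isLUB_dia w _).2 (by rintro _ ⟨w', -, rfl⟩; exact le_rfl)
    · rw [Model.eval_imp_eq_one, Model.eval_mul]
      by_cases hw : idx w < i
      · rw [hnext w _ _ exy (fun h h' => Nat.add_le_add (hmono h h').1 (hmono h h').2) hw,
          hnext w _ _ ex (fun h h' => (hmono h h').1) hw,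
          hnext w _ _ ey (fun h h' => (hmono h h').2) hw, pow_add]
      · rw [hs.box_of_dead_end (hdead w hw), hs.box_of_dead_end (hdead w hw),
          hs.box_of_dead_end (hdead w hw), one_mul]
    · rw [eval_stepFormula_eq_one hch]
      by_cases hw : idx w < i
      · obtain ⟨t, ht, h₁, h₂⟩ := hfg (idx w) hw
        obtain ⟨w', hw'⟩ := hsurj (idx w + 1) hw
        refine Or.inl ⟨t, ht, eval_formula_eq_one.2
          ⟨Model.eval_neg_box_zero hs (w' := w') ((hR _ _).2 (by omega)), ?_, ?_⟩⟩
        · rw [hnext w _ _ ex (fun h h' => (hmono h h').1) hw, ex, ez, h₁, pow_add, mul_comm t.p,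
            pow_mul]
        · rw [hnext w _ _ ey (fun h h' => (hmono h h').2) hw, ey, ez, h₂, pow_add, mul_comm t.r,
            pow_mul]
      · have hi : idx w = i := le_antisymm (hidx w) (not_lt.1 hw)
        exact Or.inr (eval_initFormula_eq_one.2 ⟨hs.box_of_dead_end (hdead w hw) _,
          by rw [ex, hi, hf, ez], by rw [ey, hi, hg, pow_zero]⟩)
  · intro h
    obtain ⟨w, hw⟩ := hsurj 0 (Nat.zero_le i)
    have ht : M.eval w (target P Q) = a ^ f 0 := by
      rw [eval_target, ey, ez, hw, ← pow_mul, ← pow_add, mul_comm, hXY]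
    have h := h w
    rw [conclusion, Model.eval_imp_eq_one, Model.eval_iff_eq_one.2 (by rw [ht, ex, hw]),
      ← eq_one_iff, Model.eval_imp_eq_one] at h
    simp only [Model.eval_mul, ht, ex, ez, hw, ← pow_add, ← pow_succ] at h
    exact ha (le_antisymm (pow_anti a (Nat.le_succ _)) h)

end AffinePair

end MVModal

/-! ## Semi-Thue systems -/

namespace SemiThue

open Relation MVModal

variable {α : Type*}

/-- One rewriting step of the semi-Thue system with the rules `R`. -/
inductive Rewrite (R : Set (List α × List α)) : List α → List α → Prop
  | mk {u v : List α} (h : (u, v) ∈ R) (l r : List α) : Rewrite R (l ++ u ++ r) (l ++ v ++ r)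

/-- The number with the digits `c a`, for the letters `a` of a word, in base `B`. -/
def num (B : ℕ) (c : α → ℕ) (w : List α) : ℕ := w.foldl (fun n a => n * B + c a) 0

section num

variable {B : ℕ} {c : α → ℕ}

theorem num_append_singleton (w : List α) (a : α) : num B c (w ++ [a]) = num B c w * B + c a := by
  simp [num]

theorem num_append (w w' : List α) : num B c (w ++ w') = B ^ w'.length * num B c w + num B c w' := by
  induction w' using List.reverseRecOn with
  | nil => simp [num]
  | append_singleton w' a ih =>
    rw [← List.append_assoc, num_append_singleton, ih, num_append_singleton, List.length_append,
      List.length_singleton, pow_succ]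
    ring

theorem num_pos (hc : ∀ a, 1 ≤ c a) {w : List α} (hw : w ≠ []) : 1 ≤ num B c w := by
  obtain ⟨w, a, rfl⟩ := (List.eq_nil_or_concat w).resolve_left hw
  rw [List.concat_eq_append, num_append_singleton]
  exact (hc a).trans (Nat.le_add_left _ _)

/-- The last digit is the remainder modulo B and the rest is the quotient; as no digit is 0, only
the empty word has number 0. -/
theorem num_injOn (hc : ∀ a, 1 ≤ c a) (hB : ∀ a, c a < B) {s : Set α} (hs : s.InjOn c)
    {w w' : List α} (hw : ∀ a ∈ w, a ∈ s) (hw' : ∀ a ∈ w', a ∈ s) (h : num B c w = num B c w') :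
    w = w' := by
  induction w using List.reverseRecOn generalizing w' with
  | nil =>
    by_contra hne
    have := num_pos (B := B) hc (Ne.symm hne)
    rw [← h] at this
    simp [num] at this
  | append_singleton w a ih =>
    rcases List.eq_nil_or_concat w' with rfl | ⟨w', a', rfl⟩
    · have := num_pos (B := B) hc (w := w ++ [a]) (by simp)
      rw [h] at this
      simp [num] at this
    · simp only [List.concat_eq_append, List.mem_append, List.mem_singleton] at hw' h hw ⊢
      rw [num_append_singleton, num_append_singleton] at h
      have h₁ := congrArg (· % B) h
      have h₂ := congrArg (· / B) h
      have hpos : 0 < B := (Nat.zero_le _).trans_lt (hB a)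
      simp only [Nat.mul_add_mod_self_right, Nat.mod_eq_of_lt (hB _)] at h₁
      simp only [Nat.add_div_of_dvd_right (Dvd.intro_left _ rfl), Nat.mul_div_cancel _ hpos,
        Nat.div_eq_of_lt (hB _), add_zero] at h₂
      rw [ih (fun b hb => hw b (Or.inl hb)) (fun b hb => hw' b (Or.inl hb)) h₂,
        hs (hw a (Or.inr rfl)) (hw' a' (Or.inr rfl)) h₁]

end num

/-! ### Coding derivations by pairs of words -/

/-- The pairs of words from which the histories of derivations are composed: rules, pairs that
copy a letter, and the pair that copies the separator `none`. -/
inductive Domino (R : Set (List α × List α)) (A : Set α) :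
    List (Option α) × List (Option α) → Prop
  | rule {u v : List α} (h : (u, v) ∈ R) : Domino R A (u.map some, v.map some)
  | copy {a : α} (h : a ∈ A) : Domino R A ([some a], [some a])
  | sep : Domino R A ([none], [none])

theorem finite_domino {R : Set (List α × List α)} {A : Set α} (hR : R.Finite) (hA : A.Finite) :
    {d | Domino R A d}.Finite := by
  refine (((hR.image fun r => (r.1.map some, r.2.map some)).union
    (hA.image fun a => ([some a], [some a]))).union (Set.finite_singleton ([none], [none]))).subset ?_
  rintro _ (⟨h⟩ | ⟨h⟩ | _)
  · exact Or.inl (Or.inl ⟨_, h, rfl⟩)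
  · exact Or.inl (Or.inr ⟨_, h, rfl⟩)
  · exact Or.inr rfl

/-- The concatenation of the first components. -/
def top (ds : List (List (Option α) × List (Option α))) : List (Option α) := ds.flatMap Prod.fst

/-- The concatenation of the second components. -/
def bottom (ds : List (List (Option α) × List (Option α))) : List (Option α) :=
  ds.flatMap Prod.snd

variable {R : Set (List α × List α)} {A : Set α}

/-- As u contains no separator, it must end before the first one. -/
theorem map_some_prefix {s u : List α} {x y : List (Option α)}
    (h : s.map some ++ none :: x = u.map some ++ y) : ∃ s', s = u ++ s' := by
  rcases List.append_eq_append_iff.1 h with ⟨a, ha, hx⟩ | ⟨b, hb, -⟩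
  · rcases a with - | ⟨o, a⟩
    · refine ⟨[], ?_⟩
      have := List.map_injective_iff.2 (Option.some_injective α) (ha.trans (List.append_nil _))
      simp [this]
    · obtain rfl : o = none := by
        simp only [List.cons_append, List.cons.injEq] at hx
        exact hx.1.symm
      have : none ∈ u.map some := by rw [ha]; simp
      simp at this
  · obtain ⟨l₁, l₂, rfl, h₁, -⟩ := List.map_eq_append_iff.1 hb
    exact ⟨l₂, by rw [List.map_injective_iff.2 (Option.some_injective α) h₁]⟩

/-- The current word is t ++ s: s is still to be read by the tops, t is already rewritten by the
bottoms. A rule rewrites at the boundary, a copy shifts it, and a separator starts a new pass. -/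
theorem reaches_of_dominoes {e : List α}
    (ds : List (List (Option α) × List (Option α))) (hds : ∀ d ∈ ds, Domino R A d) (s t : List α)
    (h : s.map some ++ none :: (t.map some ++ bottom ds) = top ds ++ (e.map some ++ [none])) :
    ReflTransGen (Rewrite R) (t ++ s) e := by
  induction ds generalizing s t with
  | nil =>
    simp only [bottom, top, List.flatMap_nil, List.append_nil, List.nil_append] at h
    -- The other side ends in a separator, so t is empty.
    rcases List.eq_nil_or_concat t with rfl | ⟨t, a, rfl⟩
    · have := List.map_injective_iff.2 (Option.some_injective α)
        (List.append_cancel_right (bs := [none]) (by simpa using h))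
      rw [← this]
      exact .refl
    · rw [List.concat_eq_append, List.map_append, ← List.cons_append, ← List.append_assoc] at h
      have := (List.append_inj' h rfl).2
      simp at this
  | cons d ds ih =>
    have hd := hds d (by simp)
    have hds' : ∀ d ∈ ds, Domino R A d := fun d hd => hds d (by simp [hd])
    have hcons : top (d :: ds) = d.1 ++ top ds ∧ bottom (d :: ds) = d.2 ++ bottom ds := by
      simp [top, bottom]
    rw [hcons.1, hcons.2, List.append_assoc] at h
    cases hd with
    | @rule u v hr =>
      obtain ⟨s', rfl⟩ := map_some_prefix h
      simp only [List.map_append, List.append_assoc, List.append_cancel_left_eq] at h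
      refine .head ?_ (ih hds' s' (t ++ v) (by simpa using h))
      simpa using Rewrite.mk hr t s'
    | @copy a ha =>
      obtain ⟨s', rfl⟩ := map_some_prefix (u := [a]) h
      simp only [List.map_append, List.map_cons, List.map_nil, List.append_assoc,
        List.append_cancel_left_eq] at h
      simpa using ih hds' s' (t ++ [a]) (by simpa using h)
    | sep =>
      cases s with
      | nil => simpa using ih hds' t [] (by simpa using h)
      | cons a s => simp at h

/-- A rewriting step is spelled by copying the left context, the rule, copying the right context,
and a separator. -/
theorem exists_dominoes {e : List α} (hRA : ∀ r ∈ R, ∀ a ∈ r.2, a ∈ A) {w : List α}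
    (h : ReflTransGen (Rewrite R) w e) (hw : ∀ a ∈ w, a ∈ A) :
    ∃ ds, (∀ d ∈ ds, Domino R A d) ∧
      w.map some ++ [none] ++ bottom ds = top ds ++ (e.map some ++ [none]) := by
  induction h using ReflTransGen.head_induction_on with
  | refl => exact ⟨[], by simp, by simp [bottom, top]⟩
  | head h' _ ih =>
    obtain @⟨u, v, hr, l, r⟩ := h'
    simp only [List.mem_append] at hw ih
    obtain ⟨ds, hds, heq⟩ := ih (by
      rintro a ((ha | ha) | ha)
      · exact hw a (Or.inl (Or.inl ha))
      · exact hRA _ hr a ha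
      · exact hw a (Or.inr ha))
    let copies : List α → List (List (Option α) × List (Option α)) := fun w =>
      w.map fun a => ([some a], [some a])
    have hc : ∀ w : List α, top (copies w) = w.map some ∧ bottom (copies w) = w.map some := by
      intro w
      induction w with
      | nil => simp [copies, top, bottom]
      | cons a w ihw => simp_all [copies, top, bottom]
    refine ⟨copies l ++ (u.map some, v.map some) :: (copies r ++ ([none], [none]) :: ds), ?_, ?_⟩
    · intro d hd
      simp only [List.mem_append, List.mem_cons, copies, List.mem_map] at hd
      rcases hd with ⟨a, ha, rfl⟩ | rfl | ⟨a, ha, rfl⟩ | rfl | hd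
      · exact .copy (hw a (Or.inl (Or.inl ha)))
      · exact .rule hr
      · exact .copy (hw a (Or.inr ha))
      · exact .sep
      · exact hds d hd
    · have h₁ := (hc l).1
      have h₂ := (hc l).2
      have h₃ := (hc r).1
      have h₄ := (hc r).2
      simp only [top, bottom] at h₁ h₂ h₃ h₄ heq
      simp only [top, bottom, List.flatMap_append, List.flatMap_cons, h₁, h₂, h₃, h₄]
      simpa using heq

/-! ### From words to numbers -/

/-- The maps that append the two words of a domino to words coded as numbers. -/
def affinePair (B : ℕ) (c : Option α → ℕ) (d : List (Option α) × List (Option α)) : AffinePair where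
  p := B ^ d.2.length
  q := num B c d.2
  r := B ^ d.1.length
  s := num B c d.1

theorem affineReach_iff {B : ℕ} {c : Option α → ℕ} {D : Set (List (Option α) × List (Option α))}
    {L : List AffinePair} (hL : ∀ t, t ∈ L ↔ ∃ d ∈ D, affinePair B c d = t) {w : List (Option α)}
    {X Y : ℕ} : AffineReach L (num B c w) X Y ↔ ∃ ds : List (List (Option α) × List (Option α)),
      (∀ d ∈ ds, d ∈ D) ∧ num B c (w ++ bottom ds) = X ∧ num B c (top ds) = Y := by
  constructor
  · intro h
    induction h with
    | init => exact ⟨[], by simp, by simp [bottom], by simp [top, num]⟩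
    | step ht _ ih =>
      obtain ⟨d, hd, rfl⟩ := (hL _).1 ht
      obtain ⟨ds, hds, rfl, rfl⟩ := ih
      refine ⟨ds ++ [d], ?_, ?_, ?_⟩
      · intro d' hd'
        rcases List.mem_append.1 hd' with h | h
        · exact hds d' h
        · exact List.mem_singleton.1 h ▸ hd
      · have : bottom (ds ++ [d]) = bottom ds ++ d.2 := by simp [bottom]
        rw [this, ← List.append_assoc, num_append]
        rfl
      · have : top (ds ++ [d]) = top ds ++ d.1 := by simp [top]
        rw [this, num_append]
        rfl
  · rintro ⟨ds, hds, rfl, rfl⟩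
    induction ds using List.reverseRecOn with
    | nil => simpa [bottom, top, num] using AffineReach.init (L := L) (x₀ := num B c w)
    | append_singleton ds d ih =>
      have h₁ : bottom (ds ++ [d]) = bottom ds ++ d.2 := by simp [bottom]
      have h₂ : top (ds ++ [d]) = top ds ++ d.1 := by simp [top]
      rw [h₁, h₂, ← List.append_assoc, num_append, num_append _ d.1]
      exact (ih fun d hd => hds d (by simp [hd])).step ((hL _).2 ⟨d, hds d (by simp), rfl⟩)

/-- Derivability in a semi-Thue system is affine reachability. -/
theorem exists_affine (hR : R.Finite) (hA : A.Finite) (hne : ∀ r ∈ R, r.1 ≠ [])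
    (hRA : ∀ r ∈ R, ∀ a ∈ r.1 ++ r.2, a ∈ A) {e : List α} (he : ∀ a ∈ e, a ∈ A) :
    ∃ (L : List AffinePair) (P Q B : ℕ) (c : Option α → ℕ), (∀ t ∈ L, t.IsGrowing) ∧ 1 ≤ P ∧
      ∀ w : List α, (∀ a ∈ w, a ∈ A) → (ReflTransGen (Rewrite R) w e ↔
        ∃ X Y, AffineReach L (num B c (w.map some ++ [none])) X Y ∧ X = P * Y + Q) := by
  classical
  let l : List (Option α) := hA.toFinset.insertNone.toList
  let S : Set (Option α) := {o | o ∈ l}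
  have hS : ∀ o, o ∈ S ↔ ∀ a ∈ o, a ∈ A := by simp [S, l, Finset.mem_insertNone]
  let c : Option α → ℕ := fun o => l.idxOf o + 1
  -- `idxOf` is `l.length` outside `l`, so digits run from 1 to `l.length + 1`.
  let B : ℕ := l.length + 2
  have hc : ∀ o, 1 ≤ c o := fun o => Nat.le_add_left _ _
  have hB : ∀ o, c o < B := fun o => Nat.succ_lt_succ (Nat.lt_succ_of_le List.idxOf_le_length)
  have hinj : S.InjOn c := fun o ho o' ho' h => (List.idxOf_inj ho).1 (Nat.succ_injective h)
  have hDS : ∀ d, Domino R A d → ∀ o ∈ d.1 ++ d.2, o ∈ S := by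
    rintro _ (⟨h⟩ | ⟨h⟩ | _) o ho
    · rw [hS]
      rintro a rfl
      refine hRA _ h a ?_
      simpa using ho
    · rw [hS]
      rintro a rfl
      simp only [List.cons_append, List.nil_append, List.mem_cons, Option.some.injEq,
        List.not_mem_nil, or_false, or_self] at ho
      exact ho ▸ h
    · rw [hS]
      rintro a rfl
      simp at ho
  have hw : ∀ w : List α, (∀ a ∈ w, a ∈ A) → ∀ o ∈ w.map some ++ [none], o ∈ S := by
    intro w hw o ho
    rw [hS]
    rintro a rfl
    exact hw a (by simpa using ho)
  have hfin := (finite_domino (A := A) hR hA).image (affinePair B c)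
  let L := hfin.toFinset.toList
  have hL : ∀ t, t ∈ L ↔ ∃ d ∈ {d | Domino R A d}, affinePair B c d = t := by simp [L]
  -- Y ↦ P·Y + Q appends e and a separator to the tops.
  refine ⟨L, B ^ (e.map some ++ [none]).length, num B c (e.map some ++ [none]), B, c, ?_,
    Nat.one_le_pow _ _ (by omega), fun w hwA => ?_⟩
  · intro t ht
    obtain ⟨d, hd, rfl⟩ := (hL t).1 ht
    -- Growth of the second map requires nonempty tops, hence nonempty left sides of rules.
    refine ⟨Nat.one_le_pow _ _ (by omega), Nat.one_le_pow _ _ (by omega), num_pos hc ?_⟩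
    rcases hd with ⟨h⟩ | _ | _
    · simpa using hne _ h
    · simp
    · simp
  · simp only [affineReach_iff hL]
    constructor
    · intro h
      obtain ⟨ds, hds, heq⟩ := exists_dominoes
        (fun r hr a ha => hRA r hr a (List.mem_append_right _ ha)) h hwA
      exact ⟨_, _, ⟨ds, hds, rfl, rfl⟩, by rw [heq, num_append]⟩
    · rintro ⟨_, _, ⟨ds, hds, rfl, rfl⟩, heq⟩
      rw [← num_append] at heq
      refine reaches_of_dominoes ds hds w [] ?_
      have := num_injOn hc hB hinj ?_ ?_ heq
      · simpa using this
      · intro o ho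
        rcases List.mem_append.1 ho with ho | ho
        · exact hw w hwA o ho
        · obtain ⟨d, hd, ho⟩ := List.mem_flatMap.1 ho
          exact hDS d (hds d hd) o (List.mem_append_right _ ho)
      · intro o ho
        rcases List.mem_append.1 ho with ho | ho
        · obtain ⟨d, hd, ho⟩ := List.mem_flatMap.1 ho
          exact hDS d (hds d hd) o (List.mem_append_left _ ho)
        · exact hw e he o ho

end SemiThue

/-! ## Stack machines as semi-Thue systems -/

namespace StackMachine

open Turing Turing.TM2 Relation SemiThue Function

variable {K G Λ σ : Type*}

/-- The letters that code the contents of the stacks. -/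
inductive Cell (K G : Type*)
  | sym (g : G)
  | bot (k : K)
  | top (k : K)

/-- The letters that code configurations: the contents of the stacks, states, and a final state. -/
inductive Letter (K G Λ σ : Type*)
  | cell (b : Cell K G)
  | state (q : Stmt (fun _ : K => G) Λ σ) (v : σ)
  | final

open Cell Letter

/-- The contents of the stacks, written one after the other, with the top of each to the right. -/
def tape (ks : List K) (S : K → List G) : List (Cell K G) :=
  ks.flatMap fun k => bot k :: ((S k).reverse.map sym ++ [top k])

/-- The last letter of a stack whose top element is `o`. -/
def mark (k : K) (o : Option G) : Cell K G := o.elim (bot k) sym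

/-- The last letter of a block shows the top element or that the stack is empty. Popping removes
that letter, except that the bottom marker stays. -/
theorem exists_mark (k : K) (L : List G) : ∃ x : List (Cell K G),
    bot k :: L.reverse.map sym = x ++ [mark k L.head?] ∧
      bot k :: L.tail.reverse.map sym = x ++ L.head?.elim [bot k] fun _ => [] := by
  cases L with
  | nil => exact ⟨[], by simp [mark]⟩
  | cons g L => exact ⟨bot k :: L.reverse.map sym, by simp [mark]⟩

theorem eq_head?_of_mark {k : K} {L : List G} {o : Option G} {x y : List (Cell K G)}
    (h : x ++ bot k :: L.reverse.map sym = y ++ [mark k o]) : o = L.head? := by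
  obtain ⟨z, hz, -⟩ := exists_mark k L
  rw [hz, ← List.append_assoc] at h
  have := (List.append_inj' h rfl).2
  cases o <;> cases hL : L.head? <;> simp_all [mark]

variable [DecidableEq K]

theorem exists_tape_eq {ks : List K} (hks : ks.Nodup) {k : K} (hk : k ∈ ks) (S : K → List G) :
    ∃ x y : List (Cell K G), top k ∉ x ∧ top k ∉ y ∧ ∀ L : List G,
      tape ks (update S k L) = x ++ bot k :: L.reverse.map sym ++ top k :: y := by
  obtain ⟨l₁, l₂, rfl⟩ := List.append_of_mem hk
  rw [List.nodup_middle, List.nodup_cons, List.mem_append, not_or] at hks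
  obtain ⟨⟨h₁, h₂⟩, -⟩ := hks
  have hn : ∀ l : List K, k ∉ l → top k ∉ tape l S := by
    intro l hl h
    obtain ⟨k', hk', h⟩ := List.mem_flatMap.1 h
    simp only [List.mem_cons, reduceCtorEq, List.mem_append, List.mem_map, and_false, exists_false,
      false_or, List.not_mem_nil, or_false, top.injEq] at h
    exact hl (h ▸ hk')
  have hu : ∀ (l : List K) (L : List G), k ∉ l → tape l (update S k L) = tape l S := by
    intro l L hl
    refine List.flatMap_congr fun k' hk' => ?_
    rw [update_of_ne (by rintro rfl; exact hl hk')]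
  refine ⟨tape l₁ S, tape l₂ S, hn _ h₁, hn _ h₂, fun L => ?_⟩
  have : tape (l₁ ++ k :: l₂) (update S k L) = tape l₁ (update S k L) ++
      (bot k :: (L.reverse.map sym ++ [top k])) ++ tape l₂ (update S k L) := by
    simp [tape]
  rw [this, hu _ _ h₁, hu _ _ h₂]
  simp

/-- `top k` occurs only once on the tape, so its position determines the block of k. -/
theorem tape_cut {ks : List K} (hks : ks.Nodup) (hall : ∀ k, k ∈ ks) {k : K} {S : K → List G}
    {x y : List (Cell K G)} (h : x ++ top k :: y = tape ks S) :
    ∃ z : List (Cell K G), x = z ++ bot k :: (S k).reverse.map sym ∧ ∀ L : List G,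
      tape ks (update S k L) = z ++ bot k :: L.reverse.map sym ++ top k :: y := by
  obtain ⟨x', y', hx, hy, hL⟩ := exists_tape_eq hks (hall k) S
  have h₁ := hL (S k)
  rw [update_eq_self, ← h] at h₁
  obtain ⟨rfl, -, rfl⟩ := (List.append_cons_inj_of_notMem (by simp [hx]) hy).1 h₁.symm
  exact ⟨x', rfl, hL⟩

/-- The machine halts when it executes a statement in a given state. -/
inductive Halts (M : Λ → Stmt (fun _ : K => G) Λ σ) :
    Stmt (fun _ : K => G) Λ σ → σ → (K → List G) → Prop
  | push {k f q v S} : Halts M q v (update S k (f v :: S k)) → Halts M (.push k f q) v S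
  | peek {k f q v S} : Halts M q (f v (S k).head?) S → Halts M (.peek k f q) v S
  | pop {k f q v S} : Halts M q (f v (S k).head?) (update S k (S k).tail) →
      Halts M (.pop k f q) v S
  | load {a q v S} : Halts M q (a v) S → Halts M (.load a q) v S
  | branch {f q₁ q₂ v S} : Halts M (cond (f v) q₁ q₂) v S → Halts M (.branch f q₁ q₂) v S
  | goto {f v S} : Halts M (M (f v)) v S → Halts M (.goto f) v S
  | halt {v S} : Halts M .halt v S

/-- A machine step runs a statement up to its `goto` or `halt`, whereas `Halts` follows its parts;
so the converse is an induction on the statement inside one on the steps. -/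
theorem halts_iff {M : Λ → Stmt (fun _ : K => G) Λ σ} {q : Stmt (fun _ : K => G) Λ σ} {v : σ}
    {S : K → List G} : Halts M q v S ↔ (StateTransition.eval (step M) (stepAux q v S)).Dom := by
  constructor
  · intro h
    induction h with
    | push _ ih => exact ih
    | peek _ ih => exact ih
    | pop _ ih => exact ih
    | load _ ih => exact ih
    | @branch f q₁ q₂ v S _ ih => cases hf : f v <;> simpa [hf] using ih
    | @goto f v S _ ih =>
      have : StateTransition.eval (step M) (stepAux (.goto f) v S) =
          StateTransition.eval (step M) (stepAux (M (f v)) v S) :=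
        StateTransition.reaches_eval (.single rfl)
      rwa [this]
    | @halt v S =>
      exact Part.dom_iff_mem.2 ⟨_, StateTransition.mem_eval.2 ⟨.refl, rfl⟩⟩
  · intro hd
    obtain ⟨b, h⟩ := Part.dom_iff_mem.1 hd
    obtain ⟨hr, hb⟩ := StateTransition.mem_eval.1 h
    clear h hd
    generalize ha : stepAux q v S = a at hr
    induction hr using ReflTransGen.head_induction_on generalizing q v S with
    | refl =>
      induction q generalizing v S with
      | push _ _ _ ih => exact .push (ih ha)
      | peek _ _ _ ih => exact .peek (ih ha)
      | pop _ _ _ ih => exact .pop (ih ha)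
      | load _ _ ih => exact .load (ih ha)
      | branch f _ _ ih₁ ih₂ =>
        refine .branch ?_
        cases hf : f v
        · exact ih₂ (by simpa [hf] using ha)
        · exact ih₁ (by simpa [hf] using ha)
      | goto f => subst ha; simp at hb
      | halt => exact .halt
    | head hc _ ih =>
      induction q generalizing v S with
      | push _ _ _ ih' => exact .push (ih' ha)
      | peek _ _ _ ih' => exact .peek (ih' ha)
      | pop _ _ _ ih' => exact .pop (ih' ha)
      | load _ _ ih' => exact .load (ih' ha)
      | branch f _ _ ih₁ ih₂ =>
        refine .branch ?_
        cases hf : f v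
        · exact ih₂ (by simpa [hf] using ha)
        · exact ih₁ (by simpa [hf] using ha)
      | goto f =>
        subst ha
        exact .goto (ih (Option.some_injective _ hc))
      | halt => exact .halt

/-- The rules for a state: it moves freely, and it acts at the top of a stack. In
`Act M x q v y x' q' v' y'` the state `(q, v)` between the words `x` and `y` becomes the state
`(q', v')` between the words `x'` and `y'`. -/
inductive Act (M : Λ → Stmt (fun _ : K => G) Λ σ) :
    List (Cell K G) → Stmt (fun _ : K => G) Λ σ → σ → List (Cell K G) →
    List (Cell K G) → Stmt (fun _ : K => G) Λ σ → σ → List (Cell K G) → Prop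
  | right (b q v) : Act M [] q v [b] [b] q v []
  | left (b q v) : Act M [b] q v [] [] q v [b]
  | push (k f q v) : Act M [] (.push k f q) v [top k] [sym (f v)] q v [top k]
  | peek (k f q v o) : Act M [mark k o] (.peek k f q) v [top k] [mark k o] q (f v o) [top k]
  | pop (k f q v o) : Act M [mark k o] (.pop k f q) v [top k]
      (o.elim [bot k] fun _ => []) q (f v o) [top k]
  | load (a q v) : Act M [] (.load a q) v [] [] q (a v) []
  | branch (f q₁ q₂ v) : Act M [] (.branch f q₁ q₂) v [] [] (cond (f v) q₁ q₂) v []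
  | goto (f v) : Act M [] (.goto f) v [] [] (M (f v)) v []

/-- The word of a state between two words on the tape. -/
def word (x : List (Cell K G)) (q : Stmt (fun _ : K => G) Λ σ) (v : σ) (y : List (Cell K G)) :
    List (Letter K G Λ σ) := x.map cell ++ state q v :: y.map cell

/-- The rules of the semi-Thue system of a stack machine. -/
inductive Rule (M : Λ → Stmt (fun _ : K => G) Λ σ) :
    List (Letter K G Λ σ) × List (Letter K G Λ σ) → Prop
  | act {x q v y x' q' v' y'} (h : Act M x q v y x' q' v' y') : Rule M (word x q v y, word x' q' v' y')
  | halt (v) : Rule M ([state .halt v], [final])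
  | left (b) : Rule M ([cell b, final], [final])
  | right (b) : Rule M ([final, cell b], [final])

/-! ### From derivations to halting computations -/

variable {M : Λ → Stmt (fun _ : K => G) Λ σ}

/-- Halting is pulled back along each act. Free moves change no stack, and the tape forces the `o`
of a peek or pop to be the actual head. -/
theorem Act.halts {ks : List K} (hks : ks.Nodup) (hall : ∀ k, k ∈ ks)
    {x q v y x' q' v' y'} (h : Act M x q v y x' q' v' y') {l r : List (Cell K G)} {S : K → List G}
    (hS : l ++ x ++ (y ++ r) = tape ks S) :
    ∃ S', l ++ x' ++ (y' ++ r) = tape ks S' ∧ (Halts M q' v' S' → Halts M q v S) := by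
  cases h with
  | right b q v => exact ⟨S, by simpa using hS, id⟩
  | left b q v => exact ⟨S, by simpa using hS, id⟩
  | push k f q v =>
    obtain ⟨z, hz, hL⟩ := tape_cut (x := l) (y := r) hks hall (by simpa using hS)
    refine ⟨_, ?_, Halts.push⟩
    rw [hL, hz]
    simp
  | peek k f q v o =>
    obtain ⟨z, hz, -⟩ := tape_cut (y := r) hks hall hS
    obtain rfl := eq_head?_of_mark hz.symm
    exact ⟨S, hS, Halts.peek⟩
  | pop k f q v o =>
    obtain ⟨z, hz, hL⟩ := tape_cut (y := r) hks hall hS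
    obtain rfl := eq_head?_of_mark hz.symm
    refine ⟨_, ?_, Halts.pop⟩
    obtain ⟨m, hm₁, hm₂⟩ := exists_mark k (S k)
    rw [hL, hm₂]
    rw [hm₁, ← List.append_assoc] at hz
    rw [List.append_cancel_right hz]
    simp
  | load a q v => exact ⟨S, hS, Halts.load⟩
  | branch f q₁ q₂ v => exact ⟨S, hS, Halts.branch⟩
  | goto f v => exact ⟨S, hS, Halts.goto⟩

omit [DecidableEq K] in
theorem cell_injective : Injective (cell : Cell K G → Letter K G Λ σ) := fun _ _ h => by
  injection h

omit [DecidableEq K] in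
theorem word_eq {x y x' y' : List (Cell K G)} {q q' : Stmt (fun _ : K => G) Λ σ} {v v' : σ}
    {l r : List (Letter K G Λ σ)} (h : l ++ word x' q' v' y' ++ r = word x q v y) :
    q' = q ∧ v' = v ∧ ∃ l' r', l = l'.map cell ∧ r = r'.map cell ∧ x = l' ++ x' ∧ y = y' ++ r' := by
  have h' : x.map cell ++ state q v :: y.map cell =
      (l ++ x'.map cell) ++ state q' v' :: (y'.map cell ++ r) := by
    rw [word, word] at h
    simpa using h.symm
  obtain ⟨h₁, h₂, h₃⟩ := (List.append_cons_inj_of_notMem (by simp) (by simp)).1 h'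
  obtain ⟨l', x'', rfl, rfl, hx⟩ := List.map_eq_append_iff.1 h₁
  obtain ⟨y'', r', rfl, hy, rfl⟩ := List.map_eq_append_iff.1 h₃
  injection h₂ with h₄ h₅
  exact ⟨h₄.symm, h₅.symm, l', r', rfl, rfl, by rw [cell_injective.list_map hx],
    by rw [cell_injective.list_map hy]⟩

theorem halts_of_reaches {ks : List K} (hks : ks.Nodup) (hall : ∀ k, k ∈ ks)
    {R : Set (List (Letter K G Λ σ) × List (Letter K G Λ σ))} (hR : ∀ r ∈ R, Rule M r)
    {w : List (Letter K G Λ σ)} (h : ReflTransGen (Rewrite R) w [final])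
    {x y : List (Cell K G)} {q : Stmt (fun _ : K => G) Λ σ} {v : σ} {S : K → List G}
    (hw : w = word x q v y) (hS : x ++ y = tape ks S) : Halts M q v S := by
  induction h using ReflTransGen.head_induction_on generalizing x q v y S with
  | refl =>
    have : state q v ∈ [final] := hw ▸ (by simp [word] : state q v ∈ word x q v y)
    simp at this
  | head hstep _ ih =>
    obtain @⟨a, b, hab, l, r⟩ := hstep
    have hfin : final ∉ word x q v y := by simp [word]
    cases hR _ hab with
    | act ha =>
      obtain ⟨rfl, rfl, l', r', rfl, rfl, rfl, rfl⟩ := word_eq hw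
      obtain ⟨S', hS', hh⟩ := ha.halts hks hall hS
      exact hh (ih (by simp [word]) hS')
    | halt v' =>
      obtain ⟨rfl, -⟩ := word_eq (x' := []) (y' := []) hw
      exact .halt
    | left b => exact (hfin (hw ▸ by simp)).elim
    | right b => exact (hfin (hw ▸ by simp)).elim

/-- The letters whose statements belong to `N`. -/
def letters (N : Set (Stmt (fun _ : K => G) Λ σ)) : Set (Letter K G Λ σ) :=
  {a | ∀ q v, a = state q v → q ∈ N}

/-- The rules in which only statements from `N` occur. -/
def rules (M : Λ → Stmt (fun _ : K => G) Λ σ) (N : Set (Stmt (fun _ : K => G) Λ σ)) :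
    Set (List (Letter K G Λ σ) × List (Letter K G Λ σ)) :=
  {r | Rule M r ∧ ∀ a ∈ r.1 ++ r.2, a ∈ letters N}

/-! ### From halting computations to derivations; finiteness of the system -/

variable {N : Set (Stmt (fun _ : K => G) Λ σ)}

omit [DecidableEq K] in
theorem cell_mem_letters (b : Cell K G) : cell b ∈ letters (Λ := Λ) (σ := σ) N := by
  simp [letters]

omit [DecidableEq K] in
theorem state_mem_letters {q : Stmt (fun _ : K => G) Λ σ} (hq : q ∈ N) (v : σ) :
    state q v ∈ letters N := by
  rintro _ _ ⟨⟩
  exact hq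

omit [DecidableEq K] in
theorem final_mem_letters : final ∈ letters N := by simp [letters]

omit [DecidableEq K] in
theorem word_mem_letters {x y : List (Cell K G)} {q : Stmt (fun _ : K => G) Λ σ} (hq : q ∈ N)
    (v : σ) : ∀ a ∈ word x q v y, a ∈ letters N := by
  intro a ha
  simp only [word, List.mem_append, List.mem_map, List.mem_cons] at ha
  rcases ha with ⟨b, -, rfl⟩ | rfl | ⟨b, -, rfl⟩
  · exact cell_mem_letters b
  · exact state_mem_letters hq v
  · exact cell_mem_letters b

omit [DecidableEq K] in
theorem Act.rewrite {x q v y x' q' v' y'} (h : Act M x q v y x' q' v' y') (hq : q ∈ N)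
    (hq' : q' ∈ N) (l r : List (Cell K G)) :
    Rewrite (rules M N) (word (l ++ x) q v (y ++ r)) (word (l ++ x') q' v' (y' ++ r)) := by
  have := Rewrite.mk (R := rules M N) (u := word x q v y) (v := word x' q' v' y') ⟨.act h, ?_⟩
    (l.map cell) (r.map cell)
  · simpa [word] using this
  · intro a ha
    rcases List.mem_append.1 ha with ha | ha
    · exact word_mem_letters hq v a ha
    · exact word_mem_letters hq' v' a ha

-- Both positions are connected through the left end of the tape.
omit [DecidableEq K] in
theorem reaches_move {x y x' y' : List (Cell K G)} {q : Stmt (fun _ : K => G) Λ σ} (hq : q ∈ N)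
    (v : σ) (h : x ++ y = x' ++ y') :
    ReflTransGen (Rewrite (rules M N)) (word x q v y) (word x' q v y') := by
  have h₁ : ∀ x y : List (Cell K G),
      ReflTransGen (Rewrite (rules M N)) (word x q v y) (word [] q v (x ++ y)) := by
    intro x
    induction x using List.reverseRecOn with
    | nil => exact fun y => .refl
    | append_singleton x b ih =>
      intro y
      have := (Act.left (M := M) b q v).rewrite hq hq x y
      rw [List.append_nil] at this
      simpa using ReflTransGen.head this (ih ([b] ++ y))
  have h₂ : ∀ x y : List (Cell K G),
      ReflTransGen (Rewrite (rules M N)) (word [] q v (x ++ y)) (word x q v y) := by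
    intro x
    induction x using List.reverseRecOn with
    | nil => exact fun y => .refl
    | append_singleton x b ih =>
      intro y
      simpa using ReflTransGen.tail (ih ([b] ++ y)) (by
        simpa using (Act.right b q v).rewrite hq hq x y)
  exact (h₁ x y).trans (h ▸ h₂ x' y')

omit [DecidableEq K] in
theorem reaches_final (x y : List (Cell K G)) :
    ReflTransGen (Rewrite (rules M N)) (x.map cell ++ final :: y.map cell) [final] := by
  have hmem : ∀ r, Rule M r → (∀ a ∈ r.1 ++ r.2, a = final ∨ ∃ b, a = cell b) → r ∈ rules M N := by
    refine fun r hr h => ⟨hr, fun a ha => ?_⟩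
    rcases h a ha with rfl | ⟨b, rfl⟩
    · exact final_mem_letters
    · exact cell_mem_letters b
  induction x using List.reverseRecOn with
  | nil =>
    induction y with
    | nil => exact .refl
    | cons b y ih =>
      refine .head ?_ ih
      simpa using Rewrite.mk (hmem _ (.right b) (by simp)) [] (y.map cell)
  | append_singleton x b ih =>
    refine .head ?_ ih
    simpa using Rewrite.mk (hmem _ (.left b) (by simp)) (x.map cell) (y.map cell)

/-- The state first moves to the top of the stack that its statement uses, then acts; closure of N
keeps all letters in the alphabet. -/
theorem reaches_of_halts {ks : List K} (hks : ks.Nodup) (hall : ∀ k, k ∈ ks)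
    (hN : ∀ q ∈ N, ∀ q' ∈ stmts₁ q, q' ∈ N) (hgoto : ∀ f, Stmt.goto f ∈ N → ∀ v, M (f v) ∈ N)
    {q : Stmt (fun _ : K => G) Λ σ} {v : σ} {S : K → List G} (h : Halts M q v S) (hq : q ∈ N)
    {x y : List (Cell K G)} (hS : x ++ y = tape ks S) :
    ReflTransGen (Rewrite (rules M N)) (word x q v y) [final] := by
  have cut : ∀ (k : K) (S : K → List G), ∃ z y : List (Cell K G), ∀ L : List G,
      tape ks (update S k L) = z ++ bot k :: L.reverse.map sym ++ top k :: y := by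
    intro k S
    obtain ⟨z, y, -, -, h⟩ := exists_tape_eq hks (hall k) S
    exact ⟨z, y, h⟩
  induction h generalizing x y with
  | @push k f q v S _ ih =>
    have hq' : q ∈ N := hN _ hq _ (by simp [stmts₁, stmts₁_self])
    obtain ⟨z, y', hL⟩ := cut k S
    have hS' := hL (S k)
    rw [update_eq_self] at hS'
    have hact := (Act.push (M := M) k f q v).rewrite hq hq' (z ++ bot k :: (S k).reverse.map sym) y'
    rw [List.append_nil] at hact
    refine (reaches_move hq v (hS.trans hS')).trans (.head hact (ih hq' ?_))
    rw [hL]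
    simp
  | @peek k f q v S _ ih =>
    have hq' : q ∈ N := hN _ hq _ (by simp [stmts₁, stmts₁_self])
    obtain ⟨z, y', hL⟩ := cut k S
    have hS' := hL (S k)
    obtain ⟨m, hm, -⟩ := exists_mark k (S k)
    rw [update_eq_self, hm, ← List.append_assoc] at hS'
    exact (reaches_move hq v (hS.trans hS')).trans
      (.head ((Act.peek k f q v _).rewrite hq hq' _ y') (ih hq' hS'.symm))
  | @pop k f q v S _ ih =>
    have hq' : q ∈ N := hN _ hq _ (by simp [stmts₁, stmts₁_self])
    obtain ⟨z, y', hL⟩ := cut k S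
    have hS' := hL (S k)
    obtain ⟨m, hm, hm'⟩ := exists_mark k (S k)
    rw [update_eq_self, hm, ← List.append_assoc] at hS'
    refine (reaches_move hq v (hS.trans hS')).trans
      (.head ((Act.pop k f q v _).rewrite hq hq' _ y') (ih hq' ?_))
    rw [hL, hm']
    simp
  | @load a q v S _ ih =>
    have hq' : q ∈ N := hN _ hq _ (by simp [stmts₁, stmts₁_self])
    refine .head ?_ (ih hq' hS)
    simpa using (Act.load (M := M) a q v).rewrite hq hq' x y
  | @branch f q₁ q₂ v S _ ih =>
    have hq' : cond (f v) q₁ q₂ ∈ N := hN _ hq _ (by cases f v <;> simp [stmts₁, stmts₁_self])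
    refine .head ?_ (ih hq' hS)
    simpa using (Act.branch (M := M) f q₁ q₂ v).rewrite hq hq' x y
  | @goto f v S _ ih =>
    have hq' := hgoto f hq v
    refine .head ?_ (ih hq' hS)
    simpa using (Act.goto (M := M) f v).rewrite hq hq' x y
  | @halt v S =>
    refine .head ?_ (reaches_final x y)
    have : ([state .halt v], [final]) ∈ rules M N := by
      refine ⟨.halt v, fun a ha => ?_⟩
      simp only [List.cons_append, List.nil_append, List.mem_cons, List.not_mem_nil, or_false] at ha
      rcases ha with rfl | rfl
      · exact state_mem_letters hq v
      · exact final_mem_letters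
    simpa [word] using Rewrite.mk this (x.map cell) (y.map cell)

omit [DecidableEq K] in
theorem finite_letters [Finite K] [Finite G] [Finite σ] (hN : N.Finite) : (letters N).Finite := by
  have h₁ : (Set.range fun b : Cell K G => (cell b : Letter K G Λ σ)).Finite := by
    have h : (Set.range (sym : G → Cell K G) ∪ Set.range bot ∪ Set.range top).Finite :=
      ((Set.finite_range _).union (Set.finite_range _)).union (Set.finite_range _)
    refine (h.image cell).subset ?_
    rintro _ ⟨b, rfl⟩
    refine ⟨b, ?_, rfl⟩
    cases b <;> simp
  refine ((h₁.union ((hN.prod (Set.finite_univ (α := σ))).image fun r => state r.1 r.2)).union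
    (Set.finite_singleton final)).subset ?_
  rintro (b | ⟨q, v⟩ | _) ha
  · exact Or.inl (Or.inl ⟨b, rfl⟩)
  · exact Or.inl (Or.inr ⟨(q, v), ⟨ha q v rfl, trivial⟩, rfl⟩)
  · exact Or.inr rfl

-- No side of a rule has more than three letters.
omit [DecidableEq K] in
theorem finite_rules [Finite K] [Finite G] [Finite σ] (hN : N.Finite) : (rules M N).Finite := by
  have : Finite (letters N) := finite_letters hN
  have hl : ((List.map Subtype.val) '' {l : List (letters N) | l.length ≤ 3}).Finite :=
    (List.finite_length_le _ 3).image _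
  have hmem : ∀ l : List (Letter K G Λ σ), (∀ a ∈ l, a ∈ letters N) → l.length ≤ 3 →
      l ∈ (List.map Subtype.val) '' {l : List (letters N) | l.length ≤ 3} := fun l hl h3 =>
    ⟨l.attach.map fun a => ⟨a.1, hl a.1 a.2⟩, by simpa using h3, by simp [List.map_map, comp_def]⟩
  refine (hl.prod hl).subset ?_
  rintro r ⟨hr, ha⟩
  have h3 : r.1.length ≤ 3 ∧ r.2.length ≤ 3 := by
    rcases hr with ⟨h⟩ | _ | _ | _
    · cases h with
      | pop k f q v o => cases o <;> simp [word]
      | _ => simp [word]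
    all_goals simp
  exact ⟨hmem _ (fun a h => ha a (List.mem_append_left _ h)) h3.1,
    hmem _ (fun a h => ha a (List.mem_append_right _ h)) h3.2⟩

omit [DecidableEq K] in
theorem rules_ne_nil : ∀ r ∈ rules M N, r.1 ≠ [] := by
  rintro r ⟨hr, -⟩
  cases hr <;> simp [word]

end StackMachine

/-! ## Undecidability -/

namespace MVModal

open Turing Relation SemiThue StackMachine

/-- A code with an undecidable halting problem on the powers of two. -/
theorem exists_code_not_computablePred :
    ∃ c : ToPartrec.Code, ¬ ComputablePred fun m : ℕ => (c.eval [2 ^ m]).Dom := by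
  let f : ℕ →. ℕ := fun m => (Denumerable.ofNat Nat.Partrec.Code m).eval 0
  have hf : Partrec f :=
    Nat.Partrec.Code.eval_part.comp (Computable.ofNat _) (Computable.const 0)
  have hpow : Computable₂ fun n m : ℕ => decide (2 ^ m = n) := by
    have h : Primrec fun m : ℕ => 2 ^ m :=
      (Primrec.nat_rec₁ 1 (f := fun _ n => n * 2)
        (Primrec.nat_mul.comp .snd (.const 2))).of_eq fun m => by
          induction m with
          | zero => rfl
          | succ m ih => rw [pow_succ, ← ih]
    have : PrimrecRel fun n m : ℕ => 2 ^ m = n := Primrec.eq.comp (h.comp .snd) .fst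
    exact this.decide.to_comp
  -- The search recovers m from 2^m, so g on powers of two is as hard as f.
  let g : ℕ →. ℕ := fun n => (Nat.rfind fun m => Part.some (decide (2 ^ m = n))).bind f
  have hg : Partrec g := (Partrec.rfind hpow.partrec₂).bind (hf.comp .snd)
  have hgf : ∀ m, g (2 ^ m) = f m := by
    intro m
    have : (Nat.rfind fun k => Part.some (decide (2 ^ k = 2 ^ m))) = Part.some m := by
      refine Part.eq_some_iff.2 (Nat.mem_rfind.2 ⟨by simp, fun {k} hk => ?_⟩)
      simp [hk.ne]
    simp only [g, this]
    exact Part.bind_some m f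
  obtain ⟨c, hc⟩ := ToPartrec.Code.exists_code (Nat.Partrec'.part_iff₁.2 hg)
  refine ⟨c, fun h => ComputablePred.halting_problem 0 ?_⟩
  refine ComputablePred.computable_of_manyOneReducible
    ⟨Encodable.encode, Computable.encode, fun c' => ?_⟩ h
  have := hc (2 ^ Encodable.encode c' ::ᵥ List.Vector.nil)
  simp only [List.Vector.head_cons, hgf] at this
  change _ ↔ (c.eval [2 ^ Encodable.encode c']).Dom
  have hv : (2 ^ Encodable.encode c' ::ᵥ List.Vector.nil).1 = [2 ^ Encodable.encode c'] := rfl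
  rw [hv] at this
  rw [this]
  simp [f]

/-! ### The stack machine of a code -/

-- The input m enters the initial word only as the number of repetitions of a letter, which makes
-- the number of that word easy to compute.
open PartrecToTM2 in
theorem trNat_two_pow (m : ℕ) : trNat (2 ^ m) = List.replicate m Γ'.bit0 ++ [Γ'.bit1] := by
  have h : ∀ m : ℕ, ∃ p : PosNum, ((2 ^ m : ℕ) : Num) = Num.pos p ∧
      trPosNum p = List.replicate m Γ'.bit0 ++ [Γ'.bit1] := by
    intro m
    induction m with
    | zero => exact ⟨1, rfl, rfl⟩
    | succ m ih =>
      obtain ⟨p, hp, hl⟩ := ih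
      refine ⟨p.bit0, ?_, ?_⟩
      · rw [pow_succ, Nat.mul_two, Nat.cast_add, hp]
        exact Num.bit0_of_bit0 (Num.pos p)
      · rw [trPosNum, hl, List.replicate_succ, List.cons_append]
  obtain ⟨p, hp, hl⟩ := h m
  rw [trNat, hp]
  exact hl

open PartrecToTM2 in
/-- Halting of a code on powers of two is derivability in a semi-Thue system. -/
theorem exists_semiThue (c : ToPartrec.Code) : ∃ (α : Type) (A : Set α)
    (R : Set (List α × List α)) (e l r : List α) (b : α), A.Finite ∧ R.Finite ∧
      (∀ p ∈ R, p.1 ≠ []) ∧ (∀ p ∈ R, ∀ a ∈ p.1 ++ p.2, a ∈ A) ∧ (∀ a ∈ e, a ∈ A) ∧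
      (∀ m : ℕ, ∀ a ∈ l ++ List.replicate m b ++ r, a ∈ A) ∧
      ∀ m : ℕ, ReflTransGen (Rewrite R) (l ++ List.replicate m b ++ r) e ↔
        (c.eval [2 ^ m]).Dom := by
  let Λs : Finset Λ' := codeSupp c Cont'.halt
  have hsupp := tr_supports c Cont'.halt
  -- The finite support of the code makes N finite, although there are infinitely many statements.
  let N : Set (TM2.Stmt (fun _ : K' => Γ') Λ' (Option Γ')) := {q | some q ∈ TM2.stmts tr Λs}
  have htr : ∀ l ∈ Λs, tr l ∈ N := fun l hl => by
    simp only [N, TM2.stmts, Finset.mem_insertNone, Finset.mem_biUnion,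
      Option.mem_def, Option.some.injEq, forall_eq']
    exact ⟨l, hl, TM2.stmts₁_self⟩
  have hNfin : N.Finite := by
    refine ((TM2.stmts tr Λs).finite_toSet.preimage (f := some) ?_).subset fun q hq => hq
    exact (Option.some_injective _).injOn
  have hNsub : ∀ q ∈ N, ∀ q' ∈ TM2.stmts₁ q, q' ∈ N := fun q hq q' hq' => TM2.stmts_trans hq' hq
  have hNgoto : ∀ f, TM2.Stmt.goto f ∈ N → ∀ v, tr (f v) ∈ N := fun f hf v =>
    htr _ ((@TM2.stmts_supportsStmt _ _ _ _ ⟨trNormal c Cont'.halt⟩ _ _ _ hsupp hf) v)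
  have hK : Finite K' := by
    refine Finite.of_surjective (fun i : Fin 4 => [K'.main, .rev, .aux, .stack].get i) ?_
    rintro (_ | _ | _ | _)
    exacts [⟨0, rfl⟩, ⟨1, rfl⟩, ⟨2, rfl⟩, ⟨3, rfl⟩]
  let ks : List K' := [.main, .rev, .aux, .stack]
  have hks : ks.Nodup := by decide
  have hall : ∀ k, k ∈ ks := by rintro (_ | _ | _ | _) <;> simp [ks]
  let q₀ := tr (trNormal c Cont'.halt)
  have hq₀ : q₀ ∈ N := htr _ hsupp.1
  let S : ℕ → K' → List Γ' := fun m => K'.elim (trList [2 ^ m]) [] [] []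
  -- Stacks are written bottom first: the input reads `cons`, `bit1`, then m times `bit0`.
  let l : List (Letter K' Γ' Λ' (Option Γ')) :=
    word [] q₀ none [.bot .main, .sym .cons, .sym .bit1]
  let r : List (Letter K' Γ' Λ' (Option Γ')) :=
    (Cell.top K'.main :: tape [K'.rev, .aux, .stack] fun _ => []).map .cell
  have hw : ∀ m, l ++ List.replicate m (.cell (.sym .bit0)) ++ r =
      word [] q₀ none (tape ks (S m)) := by
    intro m
    simp [l, r, word, tape, ks, S, K'.elim, trList, trNat_two_pow]
  refine ⟨Letter K' Γ' Λ' (Option Γ'), letters N, rules tr N, [.final], l, r,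
    .cell (.sym .bit0), finite_letters hNfin, finite_rules hNfin, rules_ne_nil, fun p hp => hp.2,
    by simpa using final_mem_letters, fun m => ?_, fun m => ?_⟩
  · rw [hw]
    exact word_mem_letters hq₀ _
  · rw [hw]
    have h₁ : (c.eval [2 ^ m]).Dom ↔ Halts tr q₀ none (S m) := by
      have h := PartrecToTM2.tr_eval c [2 ^ m]
      have h' : StateTransition.eval (TM2.step tr) (init c [2 ^ m]) =
          StateTransition.eval (TM2.step tr) (TM2.stepAux q₀ none (S m)) :=
        StateTransition.reaches_eval (.single rfl)
      refine Iff.trans ?_ halts_iff.symm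
      rw [← h', h]
      rfl
    rw [h₁]
    exact ⟨fun h => halts_of_reaches hks hall (fun r hr => hr.1) h rfl rfl,
      fun h => reaches_of_halts hks hall hNsub hNgoto h hq₀ rfl⟩

theorem primrec_num (B : ℕ) {α : Type} (c : α → ℕ) (l r : List α) (b : α) :
    Primrec fun m : ℕ => num B c (l ++ List.replicate m b ++ r) := by
  have h : Primrec fun m : ℕ => num B c (l ++ List.replicate m b) := by
    refine (Primrec.nat_rec₁ (num B c l) (f := fun _ n => n * B + c b) ?_).of_eq fun m => ?_
    · exact Primrec.nat_add.comp (Primrec.nat_mul.comp .snd (.const B)) (.const _)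
    · induction m with
      | zero => simp
      | succ m ih =>
        simp only [List.replicate_succ', ← List.append_assoc, num_append_singleton, ← ih]
  refine (Primrec.nat_add.comp (Primrec.nat_mul.comp (.const (B ^ r.length)) h)
    (.const (num B c r))).of_eq fun m => ?_
  rw [num_append _ r]

/-! ### Computability of the reduction -/

namespace Formula

/-- The operation is computed on Gödel numbers and the result decoded. -/
theorem primrec_binary {op : Formula → Formula → Formula} (k : ℕ)
    (h : ∀ φ ψ, code (op φ ψ) = 7 * Nat.pair (code φ) (code ψ) + k + 2) : Primrec₂ op := by
  refine ((Primrec.ofNat Formula).comp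
    (g := fun p : Formula × Formula => 7 * Nat.pair (code p.1) (code p.2) + k + 2) ?_).of_eq fun p => ?_
  · have hc : Primrec code := Primrec.encode
    exact Primrec.nat_add.comp (Primrec.nat_add.comp (Primrec.nat_mul.comp (.const 7)
      (Primrec₂.natPair.comp (hc.comp .fst) (hc.comp .snd))) (.const k)) (.const 2)
  · rw [← h]
    exact ofCode_code _

theorem primrec_mul : Primrec₂ mul := primrec_binary 3 fun _ _ => rfl

theorem primrec_and : Primrec₂ and := primrec_binary 1 fun _ _ => rfl

theorem primrec_or : Primrec₂ or := primrec_binary 2 fun _ _ => rfl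

theorem primrec_imp : Primrec₂ imp := primrec_binary 4 fun _ _ => rfl

theorem primrec_pow (φ : Formula) : Primrec (pow φ) :=
  Primrec.nat_rec₁ one (f := fun _ ψ => mul ψ φ) (primrec_mul.comp .snd (.const φ))

end Formula

namespace AffinePair

open Formula

theorem primrec_initFormula : Primrec initFormula := by
  have h := primrec_pow (var 2)
  exact primrec_and.comp (.const _) (primrec_and.comp
    (primrec_and.comp (primrec_imp.comp (.const _) h) (primrec_imp.comp h (.const _))) (.const _))

theorem primrec_stepFormula (L : List AffinePair) : Primrec (stepFormula L) := by
  induction L with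
  | nil => exact primrec_initFormula
  | cons t L ih => exact primrec_or.comp (.const t.formula) ih

theorem primrec_premises (L : List AffinePair) : Primrec (premises L) :=
  Primrec.list_cons.comp (.const _) (Primrec.list_cons.comp (.const _)
    (Primrec.list_cons.comp (.const _)
      (Primrec.list_cons.comp (primrec_stepFormula L) (.const []))))

end AffinePair

theorem mem_globalLogic_iff {C : Set Model.{u, v}} {Γ : List Formula} {φ : Formula} :
    ({γ | γ ∈ Γ}, φ) ∈ globalLogic C ↔
      ∀ M ∈ C, (∀ γ ∈ Γ, M.Satisfies γ) → M.Satisfies φ := by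
  classical
  constructor
  · rintro ⟨Γ₀, hΓ₀, h⟩ M hM hΓ
    exact h M hM fun γ hγ => hΓ γ (hΓ₀ hγ)
  · intro h
    exact ⟨Γ.toFinset, by intro γ; simp, fun M hM hΓ => h M hM fun γ hγ => hΓ γ (by simpa using hγ)⟩

/-- Each m is sent to a rule depending on m only through x₀, which is valid exactly when the code
diverges at 2^m. The rules use three variables, so the same reduction serves the fragment. -/
theorem not_isDecidable {𝔸 : Set FLewAlg.{u}} (hchain : ∀ A ∈ 𝔸, A.IsChain)
    (hsat : ∀ A ∈ 𝔸, A.IsWeaklySaturated) (hcontr : ∀ n : ℕ, ∃ A ∈ 𝔸, ¬ A.IsContractive n)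
    {T : Set Frame.{v}} (hT : ∀ F ∈ T, F.IsTransitive)
    (hT' : ∀ i : ℕ, ∃ F ∈ T, Nonempty ((Frame.strictOrder i).R ≃r F.R)) :
    ¬ IsDecidable (globalLogic (modelsOver T 𝔸)) ∧
      ¬ IsDecidable (fragment 3 (globalLogic (modelsOver T 𝔸))) := by
  obtain ⟨c, hc⟩ := exists_code_not_computablePred
  obtain ⟨α, A, R, e, l, r, b, hA, hR, hne, hRA, he, hw, hiff⟩ := exists_semiThue c
  obtain ⟨L, P, Q, B, d, hL, hP, hreach⟩ := exists_affine hR hA hne hRA he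
  let x₀ : ℕ → ℕ := fun m => num B d ((l ++ List.replicate m b ++ r).map some ++ [none])
  have hx₀ : Primrec x₀ := by
    refine (primrec_num B d (l.map some) (r.map some ++ [none]) (some b)).of_eq fun m => ?_
    simp [x₀]
  let f : ℕ → List Formula × Formula := fun m =>
    (AffinePair.premises L (x₀ m), AffinePair.conclusion P Q)
  have hf : Computable f := (((AffinePair.primrec_premises L).comp hx₀).pair (.const _)).to_comp
  have key : ∀ m, ({γ | γ ∈ (f m).1}, (f m).2) ∈ globalLogic (modelsOver T 𝔸) ↔
      ¬ (c.eval [2 ^ m]).Dom := by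
    intro m
    rw [mem_globalLogic_iff, ← hiff m, hreach _ (hw m)]
    constructor
    · rintro h ⟨X, Y, hXY, heq⟩
      obtain ⟨M, hM, hΓ, hφ⟩ :=
        AffinePair.exists_model_of_affineReach hchain hcontr hT' hL hXY heq
      exact hφ (h M hM hΓ)
    · intro h M hM hΓ
      by_contra hφ
      exact h (AffinePair.affineReach_of_model hM.1 (hT _ hM.2.1) (hchain _ hM.2.2)
        (hsat _ hM.2.2) hL hP hΓ hφ)
  have reduce : ∀ 𝓛 : Set (Set Formula × Formula),
      (∀ m, ({γ | γ ∈ (f m).1}, (f m).2) ∈ 𝓛 ↔ ¬ (c.eval [2 ^ m]).Dom) → ¬ IsDecidable 𝓛 := by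
    intro 𝓛 h𝓛 hdec
    have : ComputablePred fun m => ¬ (c.eval [2 ^ m]).Dom :=
      ComputablePred.computable_of_manyOneReducible ⟨f, hf, fun m => (h𝓛 m).symm⟩ hdec
    exact hc (this.not.of_eq fun m => not_not)
  refine ⟨reduce _ key, reduce _ fun m => ?_⟩
  rw [← key]
  exact ⟨fun h => h.1, fun h =>
    ⟨h, AffinePair.vars_premises L (x₀ m), AffinePair.vars_conclusion P Q⟩⟩

theorem exists_transitive_strictOrder (i : ℕ) : ∃ F ∈ {F : Frame.{v} | F.IsTransitive},
    Nonempty ((Frame.strictOrder i).R ≃r F.R) :=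
  ⟨{ World := ULift.{v} (Frame.strictOrder i).World
     nonempty := ⟨⟨⟨0, Nat.zero_le i⟩⟩⟩
     R := fun x y => (Frame.strictOrder i).R x.down y.down },
    fun _ _ _ h h' => Nat.lt_trans h h', ⟨⟨Equiv.ulift.symm, Iff.rfl⟩⟩⟩

end MVModal

theorem mainTheorem7 (𝔸 : Set MVModal.FLewAlg.{u})
    (hchain : ∀ A ∈ 𝔸, A.IsChain)
    (hsat : ∀ A ∈ 𝔸, A.IsWeaklySaturated)
    (hcontr : ∀ n : ℕ, ∃ A ∈ 𝔸, ¬ A.IsContractive n) :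
    (∀ T : Set MVModal.Frame.{v},
      (∀ F ∈ T, F.IsTransitive) →
      (∀ i : ℕ, ∃ F ∈ T, Nonempty ((MVModal.Frame.strictOrder i).R ≃r F.R)) →
        ¬ MVModal.IsDecidable (MVModal.globalLogic (MVModal.modelsOver T 𝔸)) ∧
        ¬ MVModal.IsDecidable (MVModal.fragment 3
            (MVModal.globalLogic (MVModal.modelsOver T 𝔸)))) ∧
    ¬ MVModal.IsDecidable (MVModal.globalLogic (MVModal.K4.{u, v} 𝔸)) ∧
    ¬ MVModal.IsDecidable (MVModal.fragment 3
        (MVModal.globalLogic (MVModal.K4.{u, v} 𝔸))) :=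
  ⟨fun _ hT hT' => MVModal.not_isDecidable hchain hsat hcontr hT hT',
    -- `K4 𝔸` is by definition the case of all transitive frames.
    MVModal.not_isDecidable hchain hsat hcontr (T := {F | F.IsTransitive}) (fun _ h => h)
      MVModal.exists_transitive_strictOrder⟩
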